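/- Let $\lambda_t\ge 2$ ($t\ge 0$) be integers, $n_0=1$, $n_{t+1}=\lambda_t n_t$, and let $(X,T,m_X)$ be the odometer: $X=\varprojlim \mathbb Z/n_t\mathbb Z$ (equivalently $\prod_t\mathbb Z/\lambda_t\mathbb Z$ with addition with carry), $Tx=x+1$, $m_X$ the normalized Haar measure. Let $\overline T$ be a uniquely ergodic homeomorphism of a compact metric space $\overline X$ with invariant probability measure $\overline{m_X}$, and let $\pi\colon\overline X\to X$ be a topological factor map (continuous, onto, $\pi\overline T=T\pi$); assume that $(\overline T,\overline{m_X})$ and $(T,m_X)$ are measure-theoretically isomorphic. Let $G$ be a compact metric group with normalized Haar measure $m_G$, let $\psi\colon X\to G$ be measurable, $T_\psi(x,g)=(Tx,\psi(x)g)$ on $(X\times G,m_X\otimes m_G)$, and assume that $T_\psi$ is ergodic. Assume that $\psi\circ\pi$ has a continuous version, i.e. that there is a continuous $\overline\psi\colon\overline X\to G$ with $\overline\psi=\psi\circ\pi$ $\overline{m_X}$-a.e.; let $\overline T_{\overline\psi}(\overline x,g)=(\overline T\,\overline x,\overline\psi(\overline x)g)$ on $\overline X\times G$. Let $r\ne s$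 be integers such that $(T_\psi)^r$ and $(T_\psi)^s$ are ergodic. For a measure-theoretic isomorphism $R$ from $(X,m_X,T^r)$ to $(X,m_X,T^s)$ let $(m_X)_R$ be the graph joining, $(m_X)_R(B\times C)=m_X(B\cap R^{-1}C)$. For a joining $\rho$ of the bases of two extensions, $\widetilde\rho$ denotes its relatively independent extension: if $\mu_x$, $\nu_y$ are the disintegrations of the measures of the two extensions over their bases, then $\widetilde\rho=\int \mu_x\otimes\nu_y\,d\rho(x,y)$, i.e. $\int F\otimes H\,d\widetilde\rho=\int \mathbb E(F|X)(x)\,\mathbb E(H|Y)(y)\,d\rho(x,y)$. Here the extensions are $X\times G\to X$ and $\overline X\times G\to\overline X$ with the product measures. A point $z$ is generic for $\mu$ under $S$ if $\frac1N\sum_{n=1}^N\delta_{S^nz}\to\mu$ weakly. Assume that every ergodic joining of $(T_\psi)^r$ and $(T_\psi)^s$ is of the form $\widetilde{(m_X)_R}$ for some isomorphism $R$ from $T^r$ to $T^s$. Let $\overline x\in\overline X$. Then there is an isomorphism $R$ from $T^r$ to $T^s$ such that $(\pi(\overline x),\pi(\overline x))$ is generic for $(m_X)_R$ under $T^r\times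 T^s$. Moreover, for every such $R$, there is a unique $\overline T^r\times\overline T^s$-invariant Borel probability measure $\overline\rho$ on $\overline X\times\overline X$ for which every point of $(\pi\times\pi)^{-1}(\pi(\overline x),\pi(\overline x))$ is generic, and 1. for each $g\in G$, the point $((\overline x,g),(\overline x,g))$ is generic for $\widetilde{\overline\rho}$ under $(\overline T_{\overline\psi})^r\times(\overline T_{\overline\psi})^s$; 2. the systems $\big((\overline T_{\overline\psi})^r\times(\overline T_{\overline\psi})^s,\widetilde{\overline\rho}\big)$ and $\big((T_\psi)^r\times(T_\psi)^s,\widetilde{(m_X)_R}\big)$ are measure-theoretically isomorphic. -/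

import Mathlib

open MeasureTheory ProbabilityTheory Filter Topology

/-- The numbers `n_t = λ_0 λ_1 ⋯ λ_{t-1}`, so that `n_0 = 1` and `n_{t+1} / n_t = λ_t`. -/
def odometerScale (lam : ℕ → ℕ) (t : ℕ) : ℕ := ∏ i ∈ Finset.range t, lam i

theorem odometerScale_dvd_succ (lam : ℕ → ℕ) (t : ℕ) :
    odometerScale lam t ∣ odometerScale lam (t + 1) :=
  ⟨lam t, by simp [odometerScale, Finset.prod_range_succ]⟩

/-- The coherent sequences in `∏ₜ ℤ/n_tℤ`, i.e. the inverse limit of the rings `ℤ/n_tℤ`. -/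
def odometerSubring (lam : ℕ → ℕ) : Subring (∀ t, ZMod (odometerScale lam t)) where
  carrier := {x | ∀ t, ZMod.castHom (odometerScale_dvd_succ lam t)
    (ZMod (odometerScale lam t)) (x (t + 1)) = x t}
  zero_mem' := fun t => by simp only [Pi.zero_apply, map_zero]
  one_mem' := fun t => by simp only [Pi.one_apply, map_one]
  add_mem' := fun {x y} hx hy t => by
    simp only [Pi.add_apply, map_add]; rw [hx t, hy t]
  mul_mem' := fun {x y} hx hy t => by
    simp only [Pi.mul_apply, map_mul]; rw [hx t, hy t]
  neg_mem' := fun {x} hx t => by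
    simp only [Pi.neg_apply, map_neg]; rw [hx t]

/-- The phase space of the odometer with quotients `λ_t = n_{t+1} / n_t`: the compact abelian group
`lim ℤ/n_tℤ` (for `λ_t ≥ 1`).  The expansion
`(x_0, x_1, …) ↦ (x_0 + x_1 n_1 + ⋯ + x_{t-1} n_{t-1} mod n_t)ₜ` identifies
`∏ₜ ℤ/λ_tℤ`, with addition with carry to the right, with this group. -/
def Odometer (lam : ℕ → ℕ) : Type := odometerSubring lam

namespace Odometer

variable (lam : ℕ → ℕ)

instance : CommRing (Odometer lam) := inferInstanceAs (CommRing (odometerSubring lam))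

/-- The subspace topology of the product topology, each `ℤ/n_tℤ` being discrete. -/
instance : TopologicalSpace (Odometer lam) :=
  inferInstanceAs (TopologicalSpace (odometerSubring lam))

instance : MeasurableSpace (Odometer lam) := borel _

instance : BorelSpace (Odometer lam) := ⟨rfl⟩

instance : PolishSpace (Odometer lam) := by
  have (t : ℕ) : Countable (ZMod (odometerScale lam t)) := by
    cases odometerScale lam t with
    | zero => exact inferInstanceAs (Countable ℤ)
    | succ n => exact inferInstanceAs (Countable (Fin (n + 1)))
  have hc : IsClosed ((odometerSubring lam : Set (∀ t, ZMod (odometerScale lam t)))) := by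
    have : ((odometerSubring lam : Set (∀ t, ZMod (odometerScale lam t)))) =
        ⋂ t, {x | ZMod.castHom (odometerScale_dvd_succ lam t)
          (ZMod (odometerScale lam t)) (x (t + 1)) = x t} := by
      ext x; simp only [Set.mem_iInter]; rfl
    rw [this]
    exact isClosed_iInter fun t =>
      isClosed_eq (continuous_of_discreteTopology.comp (continuous_apply (t + 1)))
        (continuous_apply t)
  exact hc.polishSpace

/-- The odometer map `T x = x + 1`, where `1 = (1, 1, 1, …)` corresponds to `(1, 0, 0, …)` in the
digit expansion. -/
def shift : Equiv.Perm (Odometer lam) := Equiv.addRight 1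

end Odometer

section ErgodicTheory

/-- `R` is a measure-theoretic isomorphism of `(X, μ, T)` and `(Y, ν, S)`. -/
structure IsMeasureIso {X Y : Type*} [MeasurableSpace X] [MeasurableSpace Y]
    (μ : Measure X) (ν : Measure Y) (T : X → X) (S : Y → Y) (R : X → Y) : Prop where
  measurePreserving : MeasurePreserving R μ ν
  equivariant : R ∘ T =ᵐ[μ] S ∘ R
  invertible : ∃ R' : Y → X, MeasurePreserving R' ν μ ∧ R' ∘ R =ᵐ[μ] id ∧ R ∘ R' =ᵐ[ν] id

/-- The systems `(X, μ, T)` and `(Y, ν, S)` are measure-theoretically isomorphic. -/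
def MeasureIsomorphic {X Y : Type*} [MeasurableSpace X] [MeasurableSpace Y]
    (μ : Measure X) (ν : Measure Y) (T : X → X) (S : Y → Y) : Prop :=
  ∃ R : X → Y, IsMeasureIso μ ν T S R

/-- `μ` is a `T`-invariant probability measure, and the only one. -/
structure IsUniquelyErgodic {X : Type*} [MeasurableSpace X] (T : X → X) (μ : Measure X) :
    Prop where
  isProbabilityMeasure : IsProbabilityMeasure μ
  measurePreserving : MeasurePreserving T μ μ
  unique : ∀ ν : Measure X, IsProbabilityMeasure ν → MeasurePreserving T ν ν → ν = μ

/-- `π` is a topological factor map from `(X', T')` onto `(X, T)`. -/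
structure IsTopologicalFactor {X' X : Type*} [TopologicalSpace X'] [TopologicalSpace X]
    (T' : X' → X') (T : X → X) (π : X' → X) : Prop where
  continuous : Continuous π
  surjective : Function.Surjective π
  equivariant : π ∘ T' = T ∘ π

/-- `κ` is an ergodic joining of `(X, μ, T)` and `(Y, ν, S)`: an ergodic `T × S`-invariant measure
with projections `μ` and `ν`. -/
structure IsErgodicJoining {X Y : Type*} [MeasurableSpace X] [MeasurableSpace Y]
    (μ : Measure X) (ν : Measure Y) (T : X → X) (S : Y → Y) (κ : Measure (X × Y)) : Prop where
  map_fst : κ.map Prod.fst = μ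
  map_snd : κ.map Prod.snd = ν
  ergodic : Ergodic (Prod.map T S) κ

/-- The graph measure `μ_R`, with `μ_R (B × C) = μ (B ∩ R⁻¹ C)`. -/
noncomputable def graphJoining {X Y : Type*} [MeasurableSpace X] [MeasurableSpace Y]
    (μ : Measure X) (R : X → Y) : Measure (X × Y) :=
  μ.map fun x => (x, R x)

/-- The relatively independent extension of a joining `ρ` of two factors `π₁ : (X', μ') → X` and
`π₂ : (Y', ν') → Y`.  If `μ'_x` and `ν'_y` denote the disintegrations of `μ'` over `X` and of `ν'`
over `Y`, this is `∫ μ'_x ⊗ ν'_y dρ(x, y)`; thus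
`∫ F ⊗ H = ∫ E(F | X)(x) E(H | Y)(y) dρ(x, y)`, which for `ρ = μ_R` is
`∫ E(F | X) · (E(H | Y) ∘ R) dμ`. -/
noncomputable def relIndepExtension {X' Y' X Y : Type*}
    [MeasurableSpace X'] [StandardBorelSpace X'] [Nonempty X']
    [MeasurableSpace Y'] [StandardBorelSpace Y'] [Nonempty Y']
    [MeasurableSpace X] [MeasurableSpace Y]
    (μ' : Measure X') [IsFiniteMeasure μ'] (ν' : Measure Y') [IsFiniteMeasure ν']
    (π₁ : X' → X) (π₂ : Y' → Y) (ρ : Measure (X × Y)) : Measure (X' × Y') :=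
  ρ.bind (Kernel.parallelComp (condDistrib id π₁ μ') (condDistrib id π₂ ν'))

/-- The skew product `T_ψ (x, g) = (T x, ψ(x) g)`. -/
def skewProduct {X G : Type*} [Group G] (T : Equiv.Perm X) (ψ : X → G) :
    Equiv.Perm (X × G) where
  toFun p := (T p.1, ψ p.1 * p.2)
  invFun p := (T.symm p.1, (ψ (T.symm p.1))⁻¹ * p.2)
  left_inv p := by simp
  right_inv p := by simp

/-- The point `z` of the compact space `Z` is generic for `μ` under `T`:
`(1/N) ∑_{1 ≤ n ≤ N} δ_{Tⁿ z} → μ` weakly. -/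
def IsGeneric {Z : Type*} [TopologicalSpace Z] [MeasurableSpace Z]
    (T : Z → Z) (z : Z) (μ : Measure Z) : Prop :=
  ∀ f : C(Z, ℝ), Tendsto (fun N : ℕ => (N : ℝ)⁻¹ * ∑ n ∈ Finset.Icc 1 N, f (T^[n] z)) atTop
    (𝓝 (∫ w, f w ∂μ))

/-- `ρ'` is an invariant probability measure for which every point over `z` is generic. -/
structure IsGenericLift {Z' Z : Type*} [TopologicalSpace Z'] [MeasurableSpace Z']
    (T' : Z' → Z') (p : Z' → Z) (z : Z) (ρ' : Measure Z') : Prop where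
  isProbabilityMeasure : IsProbabilityMeasure ρ'
  measurePreserving : MeasurePreserving T' ρ' ρ'
  isGeneric : ∀ z' : Z', p z' = z → IsGeneric T' z' ρ'

end ErgodicTheory

/-! Everything rests on one principle: if a point projects to a generic point of `β`, every limit of
its empirical measures is an invariant measure over `β`. So if there is only one invariant measure
over `β`, the point is generic for it. The proof climbs a tower, establishing this uniqueness at
each level.

Odometer: ergodicity of `T^r` makes `r` a unit of the ring `Odometer lam`. The map `R x = a +
(s/r)(x - a)` fixes `a = π x'` and intertwines `T^r` with `T^s`, so the orbit of `(a, a)` runs along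
the graph of `R`; unique ergodicity of `T^r` gives genericity for the graph joining.

Base `X'`: since the systems are isomorphic, `π` has an almost everywhere inverse `σ`. An invariant
measure over the graph joining has both marginals equal to `mX'`, hence it lives where `π × π` is
invertible and must be the image `ρ` of the graph joining under `σ × σ`.

Group extension: any ergodic measure over `ρ` projects to an ergodic joining of the powers of `T_ψ`,
which by hypothesis is relatively independent. Hence the relatively independent extension of `ρ` is
itself ergodic. Averaging an arbitrary invariant measure over `ρ` by the right action of `G × G`
yields this extension, and its ergodicity forces the measure to equal its average (Furstenberg's
argument, `eq_of_map_prod_eq_ergodic`). -/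

/-! ### Empirical measures, genericity and invariant measures over a factor. -/

section TopologicalDynamics

variable {K B : Type*} [TopologicalSpace K] [MeasurableSpace K] [BorelSpace K]
  [TopologicalSpace B] [MeasurableSpace B] [BorelSpace B]

/-- The empirical measure of the orbit segment `S z, …, S ^ (N + 1) z`. -/
noncomputable def empiricalMeasure {K : Type*} [MeasurableSpace K] (S : K → K) (z : K) (N : ℕ) :
    ProbabilityMeasure K :=
  ⟨((N + 1 : ℕ) : ENNReal)⁻¹ • ∑ n ∈ Finset.Icc 1 (N + 1), Measure.dirac (S^[n] z), ⟨by
    simp only [Measure.smul_apply, Measure.finsetSum_apply, measure_univ, smul_eq_mul,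
      Finset.sum_const, Nat.card_Icc, Nat.add_sub_cancel, nsmul_eq_mul, mul_one]
    exact ENNReal.inv_mul_cancel (by simp) (ENNReal.natCast_ne_top _)⟩⟩

theorem integral_empiricalMeasure (S : K → K) (z : K) (N : ℕ) (f : C(K, ℝ)) :
    ∫ w, f w ∂(empiricalMeasure S z N : Measure K) =
      ((N + 1 : ℕ) : ℝ)⁻¹ * ∑ n ∈ Finset.Icc 1 (N + 1), f (S^[n] z) := by
  have hf : StronglyMeasurable f := f.continuous.stronglyMeasurable
  have h : ∀ n, ∫ w, f w ∂(Measure.dirac (S^[n] z)) = f (S^[n] z) := fun n =>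
    integral_dirac' _ _ hf
  simp only [empiricalMeasure, ProbabilityMeasure.coe_mk]
  rw [integral_smul_measure, integral_finsetSum_measure]
  · simp only [h, smul_eq_mul, ENNReal.toReal_inv, ENNReal.toReal_natCast]
  · intro i _
    exact integrable_dirac' hf (by simp)

theorem measure_eq_of_forall_integral_eq [HasOuterApproxClosed K] {μ ν : Measure K} [IsFiniteMeasure μ] [IsFiniteMeasure ν]
    (h : ∀ f : C(K, ℝ), ∫ w, f w ∂μ = ∫ w, f w ∂ν) : μ = ν :=
  ext_of_forall_integral_eq_of_IsFiniteMeasure fun f => h f.toContinuousMap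

theorem isGeneric_iff_tendsto_empiricalMeasure [CompactSpace K] (S : K → K) (z : K) (μ : ProbabilityMeasure K) :
    IsGeneric S z (μ : Measure K) ↔ Tendsto (empiricalMeasure S z) atTop (𝓝 μ) := by
  rw [ProbabilityMeasure.tendsto_iff_forall_integral_tendsto, IsGeneric]
  have key : ∀ f : C(K, ℝ), (Tendsto (fun N : ℕ => (N : ℝ)⁻¹ * ∑ n ∈ Finset.Icc 1 N, f (S^[n] z))
      atTop (𝓝 (∫ w, f w ∂μ)) ↔ Tendsto (fun N => ∫ w, f w ∂(empiricalMeasure S z N : Measure K))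
      atTop (𝓝 (∫ w, f w ∂μ))) := fun f => by
    simp_rw [integral_empiricalMeasure]
    -- `empiricalMeasure S z N` averages `N + 1` points, which keeps it a probability measure at `N
    -- = 0`; the two sequences differ by one index.
    exact (tendsto_add_atTop_iff_nat 1).symm
  exact ⟨fun h f => (key f.toContinuousMap).1 (h _),
    fun h f => (key f).2 (h (BoundedContinuousFunction.mkOfCompact f))⟩

theorem IsGeneric.unique [HasOuterApproxClosed K] {S : K → K} {z : K} {μ ν : Measure K} [IsFiniteMeasure μ]
    [IsFiniteMeasure ν] (hμ : IsGeneric S z μ) (hν : IsGeneric S z ν) : μ = ν :=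
  measure_eq_of_forall_integral_eq fun f => tendsto_nhds_unique (hμ f) (hν f)

variable [CompactSpace K] [HasOuterApproxClosed K]

/-- The Krylov–Bogolyubov argument. Ultrafilters give a limit by compactness with no choice of
subsequence, and they also test full convergence in `isGeneric_of_unique_invariant`. -/
theorem exists_invariant_limit {S : K → K} (hS : Continuous S) [T2Space K]
    {p : K → B} (hp : Continuous p) {SB : B → B} (hpS : p ∘ S = SB ∘ p)
    [HasOuterApproxClosed B] {β : Measure B} [IsFiniteMeasure β]
    {z : K} (hβ : IsGeneric SB (p z) β) (U : Ultrafilter ℕ) (hU : (U : Filter ℕ) ≤ atTop) :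
    ∃ μ : ProbabilityMeasure K, Tendsto (empiricalMeasure S z) U (𝓝 μ) ∧
      MeasurePreserving S (μ : Measure K) μ ∧ (μ : Measure K).map p = β := by
  have hcpt := isCompact_univ (X := ProbabilityMeasure K)
  obtain ⟨μ, -, hμ⟩ := hcpt.ultrafilter_le_nhds (U.map (empiricalMeasure S z)) (by simp)
  have hμ' : Tendsto (empiricalMeasure S z) U (𝓝 μ) := hμ
  have hint (f : C(K, ℝ)) : Tendsto (fun N : ℕ => ((N + 1 : ℕ) : ℝ)⁻¹ *
      ∑ n ∈ Finset.Icc 1 (N + 1), f (S^[n] z)) U (𝓝 (∫ w, f w ∂(μ : Measure K))) := by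
    have := ProbabilityMeasure.tendsto_iff_forall_integral_tendsto.1 hμ'
      (BoundedContinuousFunction.mkOfCompact f)
    refine this.congr fun N => ?_
    exact integral_empiricalMeasure S z N f
  refine ⟨μ, hμ', ⟨hS.measurable, ?_⟩, ?_⟩
  · have := Measure.isProbabilityMeasure_map (μ := (μ : Measure K)) hS.measurable.aemeasurable
    refine measure_eq_of_forall_integral_eq fun f => ?_
    rw [integral_map hS.measurable.aemeasurable f.continuous.aestronglyMeasurable]
    have h1 := (hint (f.comp ⟨S, hS⟩)).sub (hint f)
    obtain ⟨C, hC⟩ : ∃ C, ∀ w, |f w| ≤ C := by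
      obtain ⟨C, hC⟩ := (isCompact_univ (X := K)).exists_bound_of_continuousOn
        f.continuous.continuousOn
      exact ⟨C, fun w => by simpa using hC w⟩
    have h2 : Tendsto (fun N : ℕ => (2 * C) / ((N : ℝ) + 1)) atTop (𝓝 0) := by
      have := (tendsto_const_div_atTop_nhds_zero_nat (2 * C)).comp (tendsto_add_atTop_nat 1)
      refine this.congr fun N => ?_
      simp
    have h3 : Tendsto (fun N : ℕ => ((N + 1 : ℕ) : ℝ)⁻¹ *
          ∑ n ∈ Finset.Icc 1 (N + 1), (f.comp ⟨S, hS⟩) (S^[n] z) - ((N + 1 : ℕ) : ℝ)⁻¹ *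
          ∑ n ∈ Finset.Icc 1 (N + 1), f (S^[n] z)) atTop (𝓝 0) := by
      refine squeeze_zero_norm (fun N => ?_) h2
      -- The sum telescopes to two boundary terms, whence the bound `2 * C / (N + 1)`.
      have e : ∑ n ∈ Finset.Icc 1 (N + 1), (f.comp ⟨S, hS⟩) (S^[n] z) -
          ∑ n ∈ Finset.Icc 1 (N + 1), f (S^[n] z) = f (S^[N + 2] z) - f (S^[1] z) := by
        rw [← Finset.sum_sub_distrib]
        have : ∀ n, (f.comp ⟨S, hS⟩) (S^[n] z) = f (S^[n + 1] z) := fun n => by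
          rw [Function.iterate_succ_apply']; rfl
        simp_rw [this]
        rw [← Finset.Ico_add_one_right_eq_Icc, Finset.sum_Ico_eq_sum_range]
        have := Finset.sum_range_sub (fun n => f (S^[n + 1] z)) (N + 1)
        simp only [Nat.add_sub_cancel] at *
        rw [← this]
        exact Finset.sum_congr rfl fun n _ => by rw [add_comm 1 n]
      rw [← mul_sub, e, norm_mul, Real.norm_eq_abs, Real.norm_eq_abs, abs_inv, Nat.abs_cast,
        inv_mul_eq_div]
      push_cast
      gcongr
      calc |f (S^[N + 2] z) - f (S^[1] z)| ≤ |f (S^[N + 2] z)| + |f (S^[1] z)| := abs_sub _ _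
        _ ≤ 2 * C := by linarith [hC (S^[N + 2] z), hC (S^[1] z)]
    have := tendsto_nhds_unique h1 (h3.mono_left hU)
    simpa [sub_eq_zero] using this
  · have := Measure.isProbabilityMeasure_map (μ := (μ : Measure K)) hp.measurable.aemeasurable
    refine measure_eq_of_forall_integral_eq fun f => ?_
    rw [integral_map hp.measurable.aemeasurable f.continuous.aestronglyMeasurable]
    have h1 := hint (f.comp ⟨p, hp⟩)
    have h2 := ((tendsto_add_atTop_iff_nat 1).2 (hβ f)).mono_left hU
    refine tendsto_nhds_unique h1 (h2.congr fun N => ?_)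
    have : ∀ n, p (S^[n] z) = SB^[n] (p z) := fun n => by
      have : Function.Semiconj p S SB := fun w => congrFun hpS w
      exact (this.iterate_right n) z
    simp [this]

theorem isGeneric_of_unique_invariant {S : K → K} (hS : Continuous S) [T2Space K]
    {p : K → B} (hp : Continuous p) {SB : B → B} (hpS : p ∘ S = SB ∘ p)
    [HasOuterApproxClosed B] {β : Measure B} [IsFiniteMeasure β]
    {z : K} (hβ : IsGeneric SB (p z) β) {m : Measure K}
    (hm : ∀ μ : Measure K, IsProbabilityMeasure μ → MeasurePreserving S μ μ → μ.map p = β → μ = m) :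
    IsGeneric S z m := by
  obtain ⟨μ₀, -, hμ₀, hμ₀'⟩ := exists_invariant_limit hS hp hpS hβ (Ultrafilter.of atTop)
    (Ultrafilter.of_le _)
  obtain rfl := hm μ₀ inferInstance hμ₀ hμ₀'
  rw [isGeneric_iff_tendsto_empiricalMeasure, tendsto_iff_ultrafilter]
  intro U hU
  obtain ⟨μ, h, h', h''⟩ := exists_invariant_limit hS hp hpS hβ U hU
  have : μ = μ₀ := ProbabilityMeasure.toMeasure_injective (hm μ inferInstance h' h'')
  exact this ▸ h

/-- An extreme point of the compact set of invariant measures over `β` is ergodic: conditioning on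
an invariant set stays in this set because `β` is ergodic. -/
theorem exists_ergodic_of_exists_invariant {S : K → K} (hS : Continuous S) [T2Space K]
    {p : K → B} (hp : Continuous p) {SB : B → B} (hpS : p ∘ S = SB ∘ p)
    [HasOuterApproxClosed B] {β : Measure B} [IsProbabilityMeasure β] (hβ : Ergodic SB β)
    (hex : ∃ μ : Measure K, IsProbabilityMeasure μ ∧ MeasurePreserving S μ μ ∧ μ.map p = β) :
    ∃ μ : Measure K, IsProbabilityMeasure μ ∧ Ergodic S μ ∧ μ.map p = β := by
  set M : Set (ProbabilityMeasure K) :=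
    {μ | MeasurePreserving S (μ : Measure K) μ ∧ (μ : Measure K).map p = β} with hM
  have hMc : IsClosed M := by
    have : M = {μ | μ.map hS.measurable.aemeasurable = μ} ∩
        {μ | μ.map hp.measurable.aemeasurable = ⟨β, inferInstance⟩} := by
      ext μ
      constructor
      · rintro ⟨h, h'⟩
        exact ⟨Subtype.ext h.map_eq, Subtype.ext h'⟩
      · rintro ⟨h, h'⟩
        exact ⟨⟨hS.measurable, congrArg Subtype.val h⟩, congrArg Subtype.val h'⟩
    rw [this]
    exact (isClosed_eq (ProbabilityMeasure.continuous_map hS) continuous_id).inter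
      (isClosed_eq (ProbabilityMeasure.continuous_map hp) continuous_const)
  -- Extreme points need a vector space, so measures are replaced by their integrals against
  -- continuous functions.
  let Φ : ProbabilityMeasure K → (C(K, ℝ) → ℝ) := fun μ f => ∫ w, f w ∂(μ : Measure K)
  have hΦ : Continuous Φ :=
    continuous_pi fun f => ProbabilityMeasure.continuous_integral_continuousMap f
  obtain ⟨μ₁, h₁, h₁', h₁''⟩ := hex
  obtain ⟨φ, ⟨μ, hμ, rfl⟩, hφ⟩ := (hMc.isCompact.image hΦ).extremePoints_nonempty
    ⟨_, Set.mem_image_of_mem Φ (show (⟨μ₁, h₁⟩ : ProbabilityMeasure K) ∈ M from ⟨h₁', h₁''⟩)⟩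
  refine ⟨μ, inferInstance, ⟨hμ.1, ⟨fun A hA hSA => ?_⟩⟩, hμ.2⟩
  have hmem {A : Set K} (hA : MeasurableSet A) (hSA : S ⁻¹' A = A) (h0 : (μ : Measure K) A ≠ 0) :
      ∃ ν ∈ M, (ν : Measure K) = (μ : Measure K)[|A] := by
    have hprob := cond_isProbabilityMeasure h0
    have hinv : MeasurePreserving S ((μ : Measure K)[|A]) ((μ : Measure K)[|A]) := by
      have := hμ.1.restrict_preimage hA
      rw [hSA] at this
      exact this.smul_measure _
    refine ⟨⟨_, hprob⟩, ⟨hinv, ?_⟩, rfl⟩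
    simp only [ProbabilityMeasure.coe_mk]
    have := Measure.isProbabilityMeasure_map (μ := (μ : Measure K)[|A]) hp.measurable.aemeasurable
    -- The projection of the conditioned measure is invariant and absolutely continuous with respect
    -- to the ergodic `β`, so it is `β`.
    refine hβ.eq_of_absolutelyContinuous ⟨hβ.measurable, ?_⟩ ?_
    · rw [Measure.map_map hβ.measurable hp.measurable, ← hpS,
        ← Measure.map_map hp.measurable hS.measurable, hinv.map_eq]
    · rw [← hμ.2]
      exact cond_absolutelyContinuous.map hp.measurable
  by_contra H
  obtain ⟨h0, h0'⟩ : (μ : Measure K) A ≠ 0 ∧ (μ : Measure K) Aᶜ ≠ 0 := by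
    simpa [eventuallyConst_set, ae_iff, and_comm] using! H
  obtain ⟨ν₁, hν₁, e₁⟩ := hmem hA hSA h0
  obtain ⟨ν₂, hν₂, e₂⟩ := hmem hA.compl (by rw [Set.preimage_compl, hSA]) h0'
  have hν : Φ ν₁ = Φ μ := by
    refine hφ (Set.mem_image_of_mem Φ hν₁) (Set.mem_image_of_mem Φ hν₂)
      ⟨(μ : Measure K).real A, (μ : Measure K).real Aᶜ,
        ENNReal.toReal_pos h0 (measure_ne_top _ _), ENNReal.toReal_pos h0' (measure_ne_top _ _),
        probReal_add_probReal_compl hA, ?_⟩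
    funext f
    have hf : Integrable f (μ : Measure K) :=
      (BoundedContinuousFunction.mkOfCompact f).integrable _
    have hc {A : Set K} (h0 : (μ : Measure K) A ≠ 0) : (μ : Measure K).real A •
        ∫ w, f w ∂((μ : Measure K)[|A]) = ∫ w in A, f w ∂(μ : Measure K) := by
      rw [ProbabilityTheory.cond, integral_smul_measure, smul_smul, ENNReal.toReal_inv,
        measureReal_def, mul_inv_cancel₀ (ENNReal.toReal_pos h0 (measure_ne_top _ _)).ne', one_smul]
    simp only [Pi.add_apply, Pi.smul_apply, Φ, e₁, e₂]
    rw [hc h0, hc h0', integral_add_compl hA hf]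
  have : (μ : Measure K)[|A] = μ := by
    rw [← e₁]
    exact measure_eq_of_forall_integral_eq fun f => congrFun hν f
  rw [← this, cond_apply hA] at h0'
  simp at h0'

/-- If averaging the invariant measure `μ` over a family of maps commuting with `S` gives an ergodic
measure `m`, then `μ = m`. -/
theorem eq_of_map_prod_eq_ergodic {H : Type*} [TopologicalSpace H] [MeasurableSpace H]
    [BorelSpace H] [FirstCountableTopology H] [SecondCountableTopologyEither K H]
    {S : K → K} {m μ : Measure K} [IsProbabilityMeasure m] [IsProbabilityMeasure μ]
    (hm : Ergodic S m) (hμ : MeasurePreserving S μ μ) (η : Measure H) [IsProbabilityMeasure η]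
    [η.IsOpenPosMeasure] {a : K × H → K} (ha : Continuous a) {e : H} (hae : ∀ z, a (z, e) = z)
    (haS : ∀ z h, S (a (z, h)) = a (S z, h)) (hmap : (μ.prod η).map a = m) : μ = m := by
  refine measure_eq_of_forall_integral_eq fun f => ?_
  have hf : Continuous fun q : K × H => f (a q) := f.continuous.comp ha
  obtain ⟨C, hC⟩ : ∃ C, ∀ w, ‖f w‖ ≤ C := by
    obtain ⟨C, hC⟩ := (isCompact_univ (X := K)).exists_bound_of_continuousOn
      f.continuous.continuousOn
    exact ⟨C, fun w => by simpa using hC w⟩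
  set F : H → ℝ := fun h => ∫ z, f (a (z, h)) ∂μ with hF
  have hFc : Continuous F := by
    refine continuous_of_dominated (F := fun h z => f (a (z, h))) (bound := fun _ => C)
      (fun h => (hf.comp (by fun_prop : Continuous fun z : K => (z, h))).aestronglyMeasurable)
      (fun h => ae_of_all _ fun z => hC _) (integrable_const _)
      (ae_of_all _ fun z => hf.comp (by fun_prop))
  have hFi : Integrable F η :=
    Integrable.of_bound hFc.aestronglyMeasurable C (ae_of_all _ fun h => by
      refine (norm_integral_le_of_norm_le_const (ae_of_all _ fun z => hC _)).trans ?_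
      simp)
  have hconst : F =ᵐ[η] fun _ => ∫ w, f w ∂m := by
    refine Integrable.ae_eq_of_forall_setIntegral_eq _ _ hFi (integrable_const _) fun A hA _ => ?_
    -- Averaging only over `A` gives an invariant measure dominated by the ergodic `m`, hence `η A •
    -- m`. So `F` has the same mean over every `A`.
    set ν : Measure K := (μ.prod (η.restrict A)).map a with hν
    have hle : ν ≤ m := by
      rw [hν, ← hmap]
      refine Measure.map_mono ?_ ha.measurable
      exact Measure.prod_mono le_rfl Measure.restrict_le_self
    have hinv : MeasurePreserving S ν ν := by
      refine ⟨hm.measurable, ?_⟩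
      rw [hν, Measure.map_map hm.measurable ha.measurable]
      have : S ∘ a = a ∘ Prod.map S id := by
        ext ⟨z, h⟩
        exact haS z h
      rw [this, ← Measure.map_map ha.measurable (hm.measurable.prodMap measurable_id),
        ← Measure.map_prod_map _ _ hm.measurable measurable_id, hμ.map_eq, Measure.map_id]
    obtain ⟨c, hc⟩ := hm.eq_smul_of_absolutelyContinuous hinv hle.absolutelyContinuous
    have hcA : c = η A := by
      have := congrArg (fun κ : Measure K => κ Set.univ) hc
      simp only [hν, Measure.smul_apply, measure_univ, smul_eq_mul, mul_one] at this
      rw [Measure.map_apply ha.measurable MeasurableSet.univ, Set.preimage_univ,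
        Measure.prod_apply MeasurableSet.univ] at this
      simpa using this.symm
    have h1 : ∫ w, f w ∂ν = ∫ h in A, F h ∂η := by
      rw [hν, integral_map ha.measurable.aemeasurable f.continuous.aestronglyMeasurable]
      refine integral_prod_symm _ ?_
      exact Integrable.of_bound hf.aestronglyMeasurable C (ae_of_all _ fun q => hC _)
    rw [← h1, hc, integral_smul_measure, hcA]
    simp [measureReal_def]
  -- `F` is continuous and `η` charges open sets, so the almost everywhere equality holds
  -- everywhere, in particular at `e`.
  have := congrFun (Measure.eq_of_ae_eq hconst hFc continuous_const) e
  simpa [hF, hae] using this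

end TopologicalDynamics

/-! ### Integer powers of semiconjugate maps and of skew products. -/

section Semiconj

/-- Equivariance is asked only along one orbit, because `ψ'` agrees with `ψ ∘ π` only almost
everywhere. For negative powers, injectivity of `B` cancels one step. -/
theorem zpow_semiconj_of_orbit {α β : Type*} {A : Equiv.Perm α} {B : Equiv.Perm β} {φ : α → β}
    {x : α} (h : ∀ n : ℤ, φ (A ((A ^ n) x)) = B (φ ((A ^ n) x))) (n : ℤ) :
    φ ((A ^ n) x) = (B ^ n) (φ x) := by
  induction n using Int.induction_on with
  | zero => simp
  | succ n ih =>
    rw [add_comm, zpow_add, zpow_add, zpow_one, zpow_one, Equiv.Perm.mul_apply,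
      Equiv.Perm.mul_apply, h, ih]
  | pred n ih =>
    have e := h (-n - 1)
    rw [← Equiv.Perm.mul_apply, ← zpow_one_add, show (1 : ℤ) + (-n - 1) = -n by ring, ih] at e
    apply B.injective
    rw [← e, ← Equiv.Perm.mul_apply, ← zpow_one_add, show (1 : ℤ) + (-n - 1) = -n by ring]

theorem zpow_semiconj {α β : Type*} {A : Equiv.Perm α} {B : Equiv.Perm β} {φ : α → β}
    (h : ∀ x, φ (A x) = B (φ x)) (n : ℤ) (x : α) : φ ((A ^ n) x) = (B ^ n) (φ x) :=
  zpow_semiconj_of_orbit (fun _ => h _) n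

theorem continuous_perm_zpow {α : Type*} [TopologicalSpace α] {A : Equiv.Perm α}
    (h : Continuous A) (h' : Continuous A.symm) (n : ℤ) : Continuous ⇑(A ^ n) := by
  let e : α ≃ₜ α := ⟨A, h, h'⟩
  have : ⇑(A ^ n) = ⇑(e ^ n) := by
    funext x
    exact (zpow_semiconj_of_orbit (A := A) (B := A) (φ := id) (fun _ => rfl) n).trans
      (by
        induction n using Int.induction_on with
        | zero => rfl
        | succ n ih => rw [add_comm, zpow_add, zpow_add, zpow_one, zpow_one]; exact congrArg A ih
        | pred n ih =>
          rw [sub_eq_neg_add, zpow_add, zpow_add, zpow_neg_one, zpow_neg_one]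
          exact congrArg A.symm ih)
  rw [this]
  exact (e ^ n).continuous

theorem skewProduct_zpow_fst {X G : Type*} [Group G] (T : Equiv.Perm X) (ψ : X → G) (n : ℤ)
    (q : X × G) : ((skewProduct T ψ ^ n) q).1 = (T ^ n) q.1 :=
  zpow_semiconj (φ := Prod.fst) (fun _ => rfl) n q

theorem skewProduct_zpow_mul {X G : Type*} [Group G] (T : Equiv.Perm X) (ψ : X → G) (n : ℤ)
    (q : X × G) (h : G) : (skewProduct T ψ ^ n) (q.1, q.2 * h) =
      (((skewProduct T ψ ^ n) q).1, ((skewProduct T ψ ^ n) q).2 * h) :=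
  (zpow_semiconj (A := skewProduct T ψ) (B := skewProduct T ψ) (φ := fun q => (q.1, q.2 * h))
    (fun x => by simp [skewProduct, mul_assoc]) n q).symm

theorem continuous_skewProduct_zpow {X G : Type*} [Group G] [TopologicalSpace X]
    [TopologicalSpace G] [IsTopologicalGroup G] (T : X ≃ₜ X) {ψ : X → G} (hψ : Continuous ψ)
    (n : ℤ) : Continuous ⇑(skewProduct T.toEquiv ψ ^ n) := by
  refine continuous_perm_zpow ?_ ?_ n
  · exact (T.continuous.comp continuous_fst).prodMk
      ((hψ.comp continuous_fst).mul continuous_snd)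
  · exact (T.symm.continuous.comp continuous_fst).prodMk
      ((hψ.comp (T.symm.continuous.comp continuous_fst)).inv.mul continuous_snd)

end Semiconj

/-! ### Images of ergodic measures and relatively independent extensions of products. -/

section Measures

theorem Ergodic.map_of_ae_semiconj {α β : Type*} [MeasurableSpace α] [MeasurableSpace β]
    {μ : Measure α} {S : α → α} {S' : β → β} {φ : α → β} (hS : Ergodic S μ) (hφ : Measurable φ)
    (hS' : Measurable S') (h : φ ∘ S =ᵐ[μ] S' ∘ φ) : Ergodic S' (μ.map φ) := by
  refine ⟨⟨hS', ?_⟩, ⟨fun A hA hSA => ?_⟩⟩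
  · rw [Measure.map_map hS' hφ, ← Measure.map_congr h, ← Measure.map_map hφ hS.measurable,
      hS.toMeasurePreserving.map_eq]
  · have h1 : S ⁻¹' (φ ⁻¹' A) =ᵐ[μ] φ ⁻¹' A := by
      rw [eventuallyEq_set]
      filter_upwards [h] with x hx
      have hx' : φ (S x) = S' (φ x) := hx
      rw [Set.mem_preimage, Set.mem_preimage, hx', ← Set.mem_preimage (f := S'), hSA]
      rfl
    -- The preimage of an invariant set is invariant only modulo null sets.
    have := hS.quasiErgodic.aeconst_set₀ (hφ hA).nullMeasurableSet h1
    rw [eventuallyConst_set'] at this ⊢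
    rcases this with h | h
    · left
      rw [ae_eq_empty] at h ⊢
      rwa [Measure.map_apply hφ hA]
    · right
      rw [eventuallyEq_univ, mem_ae_iff] at h ⊢
      rwa [Measure.map_apply hφ hA.compl]

/-- For fixed `z`, left translation by `k z` preserves `η`; averaging thus erases the fibre
coordinate and only the projection of `μ` survives. -/
theorem map_prod_mul_left {Z Y H : Type*} [MeasurableSpace Z] [MeasurableSpace Y]
    [MeasurableSpace H] [Group H] [MeasurableMul₂ H] {p : Z → Y} {k : Z → H} {j : Y × H → Z}
    (hp : Measurable p) (hk : Measurable k) (hj : Measurable j) (μ : Measure Z) [SFinite μ]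
    (η : Measure H) [SFinite η] [η.IsMulLeftInvariant] [SFinite (μ.map p)] :
    (μ.prod η).map (fun q => j (p q.1, k q.1 * q.2)) = ((μ.map p).prod η).map j := by
  have h1 : MeasurePreserving (fun q : Z × H => (q.1, k q.1 * q.2)) (μ.prod η) (μ.prod η) :=
    (MeasurePreserving.id μ).skew_product (g := fun z h => k z * h) (by fun_prop)
      (ae_of_all _ fun z => map_mul_left_eq_self η (k z))
  have : (fun q : Z × H => j (p q.1, k q.1 * q.2)) =
      j ∘ Prod.map p id ∘ fun q : Z × H => (q.1, k q.1 * q.2) := rfl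
  rw [this, ← Measure.map_map hj (by fun_prop), ← Measure.map_map (by fun_prop) h1.measurable,
    h1.map_eq, ← Measure.map_prod_map _ _ hp measurable_id, Measure.map_id]

/-- The regrouping `((x, y), (g, h)) ↦ ((x, g), (y, h))`. -/
def prodRegroup {X Y G H : Type*} (q : (X × Y) × (G × H)) : (X × G) × (Y × H) :=
  ((q.1.1, q.2.1), (q.1.2, q.2.2))

theorem measurable_prodRegroup {X Y G H : Type*} [MeasurableSpace X] [MeasurableSpace Y]
    [MeasurableSpace G] [MeasurableSpace H] :
    Measurable (prodRegroup : (X × Y) × (G × H) → (X × G) × (Y × H)) := by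
  unfold prodRegroup
  fun_prop

theorem condDistrib_id_fst_prod {X G : Type*} [MeasurableSpace X] [MeasurableSpace G]
    [StandardBorelSpace (X × G)] [Nonempty (X × G)] (μ : Measure X) [IsProbabilityMeasure μ]
    (η : Measure G) [IsProbabilityMeasure η] :
    ∀ᵐ x ∂μ, condDistrib id Prod.fst (μ.prod η) x = η.map (Prod.mk x) := by
  have hm : Measurable fun x : X => η.map (Prod.mk x) := Measurable.map_prodMk_left
  let κ : Kernel X (X × G) := ⟨fun x => η.map (Prod.mk x), hm⟩
  have : IsMarkovKernel κ :=
    ⟨fun x => Measure.isProbabilityMeasure_map (by fun_prop)⟩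
  have key := condDistrib_ae_eq_of_measure_eq_compProd (μ := μ.prod η) (Y := (id : X × G → X × G))
    (κ := κ) (Prod.fst : X × G → X) aemeasurable_id ?_
  · rwa [measurePreserving_fst.map_eq] at key
  · rw [measurePreserving_fst.map_eq]
    ext A hA
    rw [Measure.compProd_apply hA, Measure.map_apply (by fun_prop) hA,
      Measure.prod_apply (by exact (show Measurable fun x : X × G => (x.1, id x) by fun_prop) hA)]
    refine lintegral_congr fun x => ?_
    change _ = (η.map (Prod.mk x)) _
    rw [Measure.map_apply (by fun_prop) (measurable_prodMk_left hA)]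
    rfl

/-- The fibre measures of a product are `δ_x ⊗ η`. Disintegrations are determined only almost
everywhere, which is why the marginals of `ρ` must be the base measures. -/
theorem relIndepExtension_prod {X Y G H : Type*} [MeasurableSpace X] [MeasurableSpace Y]
    [MeasurableSpace G] [MeasurableSpace H] [StandardBorelSpace (X × G)] [Nonempty (X × G)]
    [StandardBorelSpace (Y × H)] [Nonempty (Y × H)]
    {μ : Measure X} [IsProbabilityMeasure μ] {ν : Measure Y} [IsProbabilityMeasure ν]
    (η : Measure G) [IsProbabilityMeasure η] (θ : Measure H) [IsProbabilityMeasure θ]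
    {ρ : Measure (X × Y)} [SFinite ρ] (h₁ : ρ.map Prod.fst = μ) (h₂ : ρ.map Prod.snd = ν) :
    relIndepExtension (μ.prod η) (ν.prod θ) Prod.fst Prod.fst ρ =
      (ρ.prod (η.prod θ)).map prodRegroup := by
  ext A hA
  rw [relIndepExtension, Measure.bind_apply hA (Kernel.aemeasurable _),
    Measure.map_apply measurable_prodRegroup hA,
    Measure.prod_apply (measurable_prodRegroup hA)]
  refine lintegral_congr_ae ?_
  have e₁ := ae_of_ae_map measurable_fst.aemeasurable
    (by rw [h₁]; exact condDistrib_id_fst_prod μ η)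
  have e₂ := ae_of_ae_map measurable_snd.aemeasurable
    (by rw [h₂]; exact condDistrib_id_fst_prod ν θ)
  filter_upwards [e₁, e₂] with q hq₁ hq₂
  rw [Kernel.parallelComp_apply, hq₁, hq₂, Measure.map_prod_map _ _ (by fun_prop) (by fun_prop),
    Measure.map_apply (by fun_prop) hA]
  rfl

end Measures

/-! ### Powers of the odometer: arithmetic, unique ergodicity, isomorphisms. -/

namespace Odometer

variable (lam : ℕ → ℕ)

instance : IsTopologicalRing (Odometer lam) :=
  inferInstanceAs (IsTopologicalRing (odometerSubring lam))

variable {lam}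

theorem odometerScale_ne_zero (hlam : ∀ t, 2 ≤ lam t) (t : ℕ) : odometerScale lam t ≠ 0 :=
  Finset.prod_ne_zero_iff.2 fun i _ => by have := hlam i; omega

theorem compactSpace (hlam : ∀ t, 2 ≤ lam t) : CompactSpace (Odometer lam) := by
  have (t : ℕ) : NeZero (odometerScale lam t) := ⟨odometerScale_ne_zero hlam t⟩
  have hc : IsClosed ((odometerSubring lam : Set (∀ t, ZMod (odometerScale lam t)))) := by
    have : ((odometerSubring lam : Set (∀ t, ZMod (odometerScale lam t)))) =
        ⋂ t, {x | ZMod.castHom (odometerScale_dvd_succ lam t)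
          (ZMod (odometerScale lam t)) (x (t + 1)) = x t} := by
      ext x; simp only [Set.mem_iInter]; rfl
    rw [this]
    exact isClosed_iInter fun t =>
      isClosed_eq (continuous_of_discreteTopology.comp (continuous_apply (t + 1)))
        (continuous_apply t)
  exact isCompact_iff_compactSpace.1 hc.isCompact

theorem castHom_coord (x : odometerSubring lam) {i t : ℕ} (h : i ≤ t) :
    ∃ h' : odometerScale lam i ∣ odometerScale lam t,
      ZMod.castHom h' (ZMod (odometerScale lam i)) (x.1 t) = x.1 i := by
  induction t, h using Nat.le_induction with
  | base => exact ⟨dvd_rfl, by simp⟩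
  | succ t _ ih =>
    obtain ⟨h', ih⟩ := ih
    refine ⟨h'.trans (odometerScale_dvd_succ lam t), ?_⟩
    rw [← ih, ← x.2 t, ← RingHom.comp_apply]
    congr 1
    exact Subsingleton.elim _ _

/-- The representatives of the coordinates of `x` modulo `n_t` converge to `x`. -/
theorem denseRange_natCast (hlam : ∀ t, 2 ≤ lam t) :
    DenseRange (Nat.cast : ℕ → Odometer lam) := by
  intro x
  have hx : Tendsto (fun t : ℕ => (((x : odometerSubring lam).1 t).val : Odometer lam)) atTop
      (𝓝 x) := by
    refine (Topology.IsInducing.subtypeVal (t := (odometerSubring lam : Set (∀ t, ZMod (odometerScale lam t))))).tendsto_nhds_iff.2 ?_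
    rw [tendsto_pi_nhds]
    intro i
    refine tendsto_const_nhds.congr' ?_
    filter_upwards [eventually_ge_atTop i] with t ht
    have : NeZero (odometerScale lam t) := ⟨odometerScale_ne_zero hlam t⟩
    obtain ⟨h', e⟩ := castHom_coord x ht
    change _ = (((((x : odometerSubring lam).1 t).val : ℕ) : odometerSubring lam).1) i
    rw [← e]
    conv_lhs => rw [← ZMod.natCast_zmod_val ((x : odometerSubring lam).1 t), map_natCast]
    rfl
  exact mem_closure_of_tendsto hx (Eventually.of_forall fun t => Set.mem_range_self _)

theorem shift_zpow_apply (n : ℤ) (x : Odometer lam) : (shift lam ^ n) x = x + n := by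
  induction n using Int.induction_on with
  | zero => simp
  | succ n ih =>
    rw [add_comm, zpow_add, zpow_one, Equiv.Perm.mul_apply, ih]
    simp only [shift, Equiv.coe_addRight]
    push_cast
    ring
  | pred n ih =>
    rw [sub_eq_neg_add, zpow_add, zpow_neg_one, Equiv.Perm.mul_apply, ih, Equiv.Perm.inv_eq_iff_eq]
    simp only [shift, Equiv.coe_addRight]
    push_cast
    ring

variable {mX : Measure (Odometer lam)} [mX.IsAddHaarMeasure]

theorem zpow_ne_zero_of_ergodic (hlam : ∀ t, 2 ≤ lam t) {r : ℤ}
    (hr : Ergodic ⇑(shift lam ^ r) mX) : r ≠ 0 := by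
  rintro rfl
  -- The identity preserves this set, yet it contains `0` and misses `1`, since `n_1 = λ_0 ≥ 2`.
  have hclopen : IsClopen {x : Odometer lam | (x : odometerSubring lam).1 1 = 0} :=
    (isClopen_discrete {(0 : ZMod (odometerScale lam 1))}).preimage
      ((continuous_apply 1).comp continuous_subtype_val)
  have h := hr.ae_empty_or_univ hclopen.isClosed.measurableSet (by
    ext y; simp)
  have h1 : odometerScale lam 1 = lam 0 := by simp [odometerScale]
  have : Fact (1 < odometerScale lam 1) := ⟨by have := hlam 0; omega⟩
  rcases h with h | h
  · rw [ae_eq_empty, hclopen.isOpen.measure_eq_zero_iff mX] at h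
    exact (h ▸ (rfl : (0 : odometerSubring lam).1 1 = 0) : (0 : Odometer lam) ∈ (∅ : Set _))
  · rw [eventuallyEq_univ, mem_ae_iff, hclopen.compl.isOpen.measure_eq_zero_iff mX,
      Set.compl_empty_iff] at h
    have h2 : (1 : Odometer lam) ∈ {x : Odometer lam | (x : odometerSubring lam).1 1 = 0} :=
      h ▸ Set.mem_univ _
    exact one_ne_zero (α := ZMod (odometerScale lam 1)) h2

variable [IsProbabilityMeasure mX]

/-- The ideal generated by `r` is closed, invariant under `T^r`, and has positive measure because
finitely many translates cover. Ergodicity gives it full measure, so it is everything and contains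
`1`. -/
theorem exists_mul_eq_one_of_ergodic (hlam : ∀ t, 2 ≤ lam t) {r : ℤ}
    (hr : Ergodic ⇑(shift lam ^ r) mX) : ∃ u : Odometer lam, (r : Odometer lam) * u = 1 := by
  have := compactSpace hlam
  have hcl (s : Odometer lam) : IsClosed (Set.range fun x : Odometer lam => s + r * x) :=
    (isCompact_range (by fun_prop)).isClosed
  have hmeas (s : Odometer lam) : mX (Set.range fun x : Odometer lam => s + r * x) =
      mX (Set.range fun x : Odometer lam => r * x) := by
    have : (Set.range fun x : Odometer lam => s + r * x) =
        (fun y => (-s) + y) ⁻¹' (Set.range fun x : Odometer lam => r * x) := by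
      ext y
      simp only [Set.mem_range, Set.mem_preimage]
      exact exists_congr fun x => ⟨fun h => by rw [← h]; ring, fun h => by rw [h]; ring⟩
    rw [this, measure_preimage_add]
  have hinv : (⇑(shift lam ^ r)) ⁻¹' (Set.range fun x : Odometer lam => r * x) =
      (Set.range fun x : Odometer lam => r * x) := by
    ext y
    simp only [Set.mem_range, Set.mem_preimage, shift_zpow_apply]
    exact ⟨fun ⟨x, h⟩ => ⟨x - 1, by rw [mul_sub, h]; ring⟩,
      fun ⟨x, h⟩ => ⟨x + 1, by rw [mul_add, h]; ring⟩⟩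
  have hr0 := zpow_ne_zero_of_ergodic hlam hr
  have hcover : (⋃ i ∈ Finset.range r.natAbs,
      Set.range fun x : Odometer lam => (i : Odometer lam) + r * x) = Set.univ := by
    have hc : IsClosed (⋃ i ∈ Finset.range r.natAbs,
        Set.range fun x : Odometer lam => (i : Odometer lam) + r * x) :=
      isClosed_biUnion_finset fun i _ => hcl i
    rw [← hc.closure_eq]
    refine Dense.closure_eq ((denseRange_natCast hlam).mono ?_)
    rintro _ ⟨n, rfl⟩
    simp only [Set.mem_iUnion, Finset.mem_range, Set.mem_range]
    -- Euclidean division covers the dense set of natural numbers; the finite union is closed.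
    refine ⟨n % r.natAbs, Nat.mod_lt _ (Int.natAbs_pos.2 hr0), ((n / r : ℤ) : Odometer lam), ?_⟩
    have : ((n % r.natAbs : ℕ) : ℤ) + r * (n / r) = n := by
      rw [Int.natCast_mod, Int.natCast_natAbs, Int.emod_abs]
      exact Int.emod_add_mul_ediv _ _
    have e := congrArg (Int.cast : ℤ → Odometer lam) this
    rwa [Int.cast_add, Int.cast_mul, Int.cast_natCast, Int.cast_natCast] at e
  have hpos : mX (Set.range fun x : Odometer lam => r * x) ≠ 0 := by
    intro h0
    have : mX Set.univ ≤ 0 := by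
      rw [← hcover]
      refine (measure_biUnion_finset_le _ _).trans ?_
      simp [hmeas, h0]
    simp at this
  have hcl0 : IsClosed (Set.range fun x : Odometer lam => r * x) := by simpa using hcl 0
  have huniv : (Set.range fun x : Odometer lam => r * x) = Set.univ := by
    rcases hr.ae_empty_or_univ hcl0.measurableSet hinv with h | h
    · exact absurd (ae_eq_empty.1 h) hpos
    · rw [eventuallyEq_univ, mem_ae_iff, hcl0.isOpen_compl.measure_eq_zero_iff mX,
        Set.compl_empty_iff] at h
      exact h
  exact (huniv ▸ Set.mem_univ (1 : Odometer lam) :)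

/-- Translations commute with `T^r`, and the convolution of `μ` with Haar measure is Haar measure.
-/
theorem eq_of_measurePreserving_shift_zpow (hlam : ∀ t, 2 ≤ lam t) {r : ℤ}
    (hr : Ergodic ⇑(shift lam ^ r) mX) (μ : Measure (Odometer lam)) [IsProbabilityMeasure μ]
    (hμ : MeasurePreserving ⇑(shift lam ^ r) μ μ) : μ = mX := by
  have := compactSpace hlam
  refine eq_of_map_prod_eq_ergodic hr hμ mX (a := fun q => q.1 + q.2) (by fun_prop) (e := 0)
    (by simp) (fun z h => by simp only [shift_zpow_apply]; ring) ?_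
  have h1 : MeasurePreserving (fun q : Odometer lam × Odometer lam => (q.1, q.1 + q.2))
      (μ.prod mX) (μ.prod mX) :=
    (MeasurePreserving.id μ).skew_product (g := fun z h => z + h) (by fun_prop)
      (ae_of_all _ fun z => map_add_left_eq_self mX z)
  exact (measurePreserving_snd.comp h1).map_eq

theorem exists_isMeasureIso_isGeneric (hlam : ∀ t, 2 ≤ lam t) {r s : ℤ}
    (hr : Ergodic ⇑(shift lam ^ r) mX) (hs : Ergodic ⇑(shift lam ^ s) mX) (a : Odometer lam) :
    ∃ R : Odometer lam → Odometer lam,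
      IsMeasureIso mX mX ⇑(shift lam ^ r) ⇑(shift lam ^ s) R ∧
      IsGeneric (Prod.map ⇑(shift lam ^ r) ⇑(shift lam ^ s)) (a, a) (graphJoining mX R) := by
  have := compactSpace hlam
  obtain ⟨u, hu⟩ := exists_mul_eq_one_of_ergodic hlam hr
  obtain ⟨w, hw⟩ := exists_mul_eq_one_of_ergodic hlam hs
  have hmp (c d : Odometer lam) (hcd : c * d = 1) :
      MeasurePreserving (fun x => a + c * (x - a)) mX mX := by
    have h1 : MeasurePreserving (AddMonoidHom.mulLeft c) mX mX :=
      AddMonoidHom.measurePreserving (by simpa using continuous_const_mul c)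
        (fun y => ⟨d * y, by simp [← mul_assoc, hcd]⟩) rfl
    exact (measurePreserving_add_left mX a).comp (h1.comp (measurePreserving_sub_right mX a))
  -- Since `u = 1/r` and `w = 1/s`, this is multiplication by `s/r` centred at `a`; its inverse is
  -- multiplication by `r * w`.
  let R : Odometer lam → Odometer lam := fun x => a + (s * u) * (x - a)
  have hRT (x) : R ((shift lam ^ r) x) = (shift lam ^ s) (R x) := by
    simp only [R, shift_zpow_apply]
    linear_combination (s : Odometer lam) * hu
  have hRc : Continuous R := by fun_prop
  refine ⟨R, ⟨hmp _ (r * w) ?_, ae_of_all _ hRT, fun x => a + (r * w) * (x - a),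
    hmp _ (s * u) ?_, ae_of_all _ fun x => ?_, ae_of_all _ fun x => ?_⟩, fun f => ?_⟩
  · linear_combination (s * w : Odometer lam) * hu + hw
  · linear_combination (s * w : Odometer lam) * hu + hw
  · simp only [R, Function.comp_apply, id]
    linear_combination ((s * w : Odometer lam) * hu + hw) * (x - a)
  · simp only [R, Function.comp_apply, id]
    linear_combination ((s * w : Odometer lam) * hu + hw) * (x - a)
  · have hc : Continuous ⇑(shift lam ^ r) := by
      simp only [funext (shift_zpow_apply (lam := lam) r)]; fun_prop
    have hgen : IsGeneric ⇑(shift lam ^ r) a mX :=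
      -- Over a one-point base the principle reduces to plain unique ergodicity.
      isGeneric_of_unique_invariant (K := Odometer lam) (B := Unit) (SB := id) (p := fun _ => ())
        (β := Measure.dirac ()) hc (by fun_prop) rfl
        (fun f => by
          refine tendsto_const_nhds.congr' ?_
          filter_upwards [eventually_ge_atTop 1] with N hN
          have : (N : ℝ) ≠ 0 := by positivity
          simp [this])
        (fun μ hμ h _ => eq_of_measurePreserving_shift_zpow hlam hr μ h)
    have := hgen ⟨fun x => f (x, R x), by fun_prop⟩
    have hmeas : Measurable fun x => (x, R x) := by fun_prop
    rw [graphJoining, integral_map hmeas.aemeasurable f.continuous.aestronglyMeasurable]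
    refine this.congr fun N => ?_
    have hsemi : Function.Semiconj (fun x => (x, R x)) ⇑(shift lam ^ r)
        (Prod.map ⇑(shift lam ^ r) ⇑(shift lam ^ s)) := fun x => Prod.ext rfl (hRT x)
    have haR : (a, R a) = (a, a) := by simp [R]
    congr 1
    refine Finset.sum_congr rfl fun n _ => ?_
    have := (hsemi.iterate_right n) a
    simp only [haR] at this
    rw [← this]
    rfl

end Odometer

/-! ### Almost invertible factor maps and measures above them. -/

theorem measurePreserving_perm_zpow {α : Type*} [MeasurableSpace α] {μ : Measure α}
    {A : Equiv.Perm α} (h : MeasurePreserving A μ μ) (h' : Measurable A.symm) (n : ℤ) :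
    MeasurePreserving ⇑(A ^ n) μ μ := by
  have h'' : MeasurePreserving A.symm μ μ := by
    refine ⟨h', ?_⟩
    conv_lhs => rw [← h.map_eq]
    rw [Measure.map_map h' h.measurable, Equiv.symm_comp_self, Measure.map_id]
  induction n using Int.induction_on with
  | zero => exact MeasurePreserving.id μ
  | succ n ih =>
    rw [add_comm, zpow_add, zpow_one]
    exact h.comp ih
  | pred n ih =>
    rw [sub_eq_neg_add, zpow_add, zpow_neg_one]
    exact h''.comp ih

theorem map_eq_of_ae_leftInverse {α β : Type*} [MeasurableSpace α] [MeasurableSpace β]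
    {μ : Measure α} {φ : α → β} {σ : β → α} (hφ : Measurable φ) (hσ : Measurable σ)
    (h : ∀ᵐ x ∂μ, σ (φ x) = x) : (μ.map φ).map σ = μ := by
  rw [Measure.map_map hσ hφ]
  conv_rhs => rw [← Measure.map_id (μ := μ)]
  exact Measure.map_congr h

/-- An invariant measure for a power of a uniquely ergodic system is absolutely continuous. -/
theorem IsUniquelyErgodic.absolutelyContinuous_of_zpow {α : Type*} [MeasurableSpace α]
    {μ : Measure α} {A : Equiv.Perm α} (hA : IsUniquelyErgodic A μ)
    {r : ℤ} (hr : r ≠ 0) {ν : Measure α} [IsProbabilityMeasure ν]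
    (hν : MeasurePreserving ⇑(A ^ r) ν ν) (hm : Measurable ⇑(A ^ (-r))) : ν ≪ μ := by
  have hAm := hA.measurePreserving.measurable
  have hν' : ν.map A^[r.natAbs] = ν := by
    have key : ν.map ⇑(A ^ (r.natAbs : ℤ)) = ν := by
      rcases Int.natAbs_eq r with h | h
      · rw [← h]; exact hν.map_eq
      · have e : (r.natAbs : ℤ) = -r := by omega
        rw [e]
        conv_lhs => rw [← hν.map_eq]
        rw [Measure.map_map hm hν.measurable, ← Equiv.Perm.coe_mul, ← zpow_add]
        simp
    rwa [zpow_natCast, ← Equiv.Perm.iterate_eq_pow] at key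
  set n := r.natAbs
  have hn : n ≠ 0 := Int.natAbs_ne_zero.2 hr
  -- The average over one period is `A`-invariant, hence equal to `μ`; its term `i = 0` is `ν`.
  set ξ : Measure α := ∑ i ∈ Finset.range n, ν.map A^[i] with hξ
  have hξinv : ξ.map A = ξ := by
    have e (i : ℕ) : (ν.map A^[i]).map A = ν.map A^[i + 1] := by
      rw [Measure.map_map hAm (hAm.iterate i), Function.iterate_succ']
    have h1 : ξ.map A = ∑ i ∈ Finset.range n, ν.map A^[i + 1] := by
      rw [hξ, ← Measure.mapₗ_apply_of_measurable hAm, map_sum]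
      simp_rw [Measure.mapₗ_apply_of_measurable hAm, e]
    obtain ⟨k, hk⟩ := Nat.exists_eq_succ_of_ne_zero hn
    rw [h1, hξ, hk, Finset.sum_range_succ, Finset.sum_range_succ', Function.iterate_zero,
      Measure.map_id]
    rw [hk] at hν'
    rw [hν']
  have hprob (i : ℕ) : (ν.map A^[i]) Set.univ = 1 := by
    rw [Measure.map_apply (hAm.iterate i) MeasurableSet.univ]
    simp
  have hξu : ((n : ENNReal)⁻¹ • ξ) = μ := by
    refine hA.unique _ ⟨?_⟩ ⟨hAm, ?_⟩
    · simp only [Measure.smul_apply, hξ, Measure.finsetSum_apply, hprob, smul_eq_mul,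
        Finset.sum_const, Finset.card_range, nsmul_eq_mul, mul_one]
      exact ENNReal.inv_mul_cancel (by simpa using hn) (ENNReal.natCast_ne_top _)
    · rw [Measure.map_smul, hξinv]
  refine Measure.AbsolutelyContinuous.mk fun B hB h0 => ?_
  rw [← hξu, Measure.smul_apply, smul_eq_mul, mul_eq_zero] at h0
  have h1 : ξ B = 0 := h0.resolve_left (by simp)
  rw [hξ, Measure.finsetSum_apply, Finset.sum_eq_zero_iff] at h1
  simpa using h1 0 (Finset.mem_range.2 (Nat.pos_of_ne_zero hn))

/-- By absolute continuity, `σ` inverts `π` also `ν`-almost everywhere, so `ν` is recovered from its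
image under `π`. -/
theorem IsUniquelyErgodic.eq_of_zpow {α β : Type*} [MeasurableSpace α] [MeasurableSpace β]
    {μ : Measure α} {A : Equiv.Perm α} (hA : IsUniquelyErgodic A μ)
    {r : ℤ} (hr : r ≠ 0) {ν : Measure α} [IsProbabilityMeasure ν]
    (hν : MeasurePreserving ⇑(A ^ r) ν ν) (hm : Measurable ⇑(A ^ (-r)))
    {π : α → β} {σ : β → α} (hπ : Measurable π) (hσ : Measurable σ)
    (hσπ : ∀ᵐ y ∂μ, σ (π y) = y) (h : ν.map π = μ.map π) : ν = μ := by
  rw [← map_eq_of_ae_leftInverse hπ hσ hσπ, ← h]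
  exact (map_eq_of_ae_leftInverse hπ hσ
    ((hA.absolutelyContinuous_of_zpow hr hν hm).ae_le hσπ)).symm

/-- A topological factor map of an extension of the odometer isomorphic to it is an isomorphism. -/
theorem Odometer.exists_ae_inverse {lam : ℕ → ℕ} {mX : Measure (Odometer lam)}
    [mX.IsAddHaarMeasure] (hT : Ergodic (shift lam) mX)
    {α : Type*} [MeasurableSpace α] {μ : Measure α} {A : α → α}
    {π : α → Odometer lam} (hπ : Measurable π) (hπA : π ∘ A = shift lam ∘ π)
    (hiso : MeasureIsomorphic mX μ (shift lam) A) :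
    ∃ σ : Odometer lam → α, MeasurePreserving σ mX μ ∧ MeasurePreserving π μ mX ∧
      (∀ᵐ x ∂mX, π (σ x) = x) ∧ ∀ᵐ y ∂μ, σ (π y) = y := by
  obtain ⟨R, hR, hRT, R', hR', hR'R, hRR'⟩ := hiso
  -- `π ∘ R` commutes with `T`, so `π (R x) - x` is invariant and therefore a constant `c`; shifting
  -- the argument of `R` by `c` gives the section.
  obtain ⟨c, hc⟩ := hT.quasiErgodic.ae_eq_const_of_ae_eq_comp₀
    (g := fun x => π (R x) - x) ((hπ.comp hR.measurable).sub measurable_id).nullMeasurable (by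
      filter_upwards [hRT] with x hx
      have hx' : R (shift lam x) = A (R x) := hx
      have hy : π (A (R x)) = π (R x) + 1 := congrFun hπA (R x)
      simp only [Function.comp_apply, hx', hy]
      simp [shift])
  have hc' : ∀ᵐ x ∂mX, π (R x) = x + c := by
    filter_upwards [hc] with x hx
    exact (sub_eq_iff_eq_add'.1 hx)
  have hsub : MeasurePreserving (fun x => x - c) mX mX := measurePreserving_sub_right mX c
  have hmp : MeasurePreserving (fun x => R (x - c)) mX μ := hR.comp hsub
  have h1 : ∀ᵐ x ∂mX, π (R (x - c)) = x := by
    filter_upwards [hsub.quasiMeasurePreserving.ae hc'] with x hx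
    rw [hx, sub_add_cancel]
  refine ⟨fun x => R (x - c), hmp, ⟨hπ, ?_⟩, h1, ?_⟩
  · rw [← hmp.map_eq]
    exact map_eq_of_ae_leftInverse hmp.measurable hπ h1
  · filter_upwards [hRR', hR'.quasiMeasurePreserving.ae hc'] with y hy hy'
    have hy'' : R (R' y) = y := hy
    rw [hy''] at hy'
    rw [hy', add_sub_cancel_right, hy'']

/-- Furstenberg's argument for group extensions: the right action of `H` commutes with `S`, and
averaging over it turns any invariant measure over `ρ` into `ρ ⊗ η`. -/
theorem eq_map_prod_of_ergodic {K Y H : Type*} [TopologicalSpace K] [MeasurableSpace K]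
    [BorelSpace K] [CompactSpace K] [HasOuterApproxClosed K] [MeasurableSpace Y]
    [Group H] [TopologicalSpace H] [IsTopologicalGroup H] [MeasurableSpace H] [BorelSpace H]
    [SecondCountableTopology H] (η : Measure H) [η.IsHaarMeasure] [IsProbabilityMeasure η]
    {p : K → Y} {k : K → H} {j : Y × H → K} (hp : Measurable p) (hk : Measurable k)
    (hj : Measurable j) (ha : Continuous fun q : K × H => j (p q.1, k q.1 * q.2))
    (hjz : ∀ z, j (p z, k z) = z) {S : K → K}
    (haS : ∀ z h, S (j (p z, k z * h)) = j (p (S z), k (S z) * h))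
    {μ : Measure K} [IsProbabilityMeasure μ] (hμ : MeasurePreserving S μ μ) {ρ : Measure Y}
    (hρ : μ.map p = ρ) (herg : Ergodic S ((ρ.prod η).map j)) : μ = (ρ.prod η).map j := by
  have h1 : IsProbabilityMeasure ρ := hρ ▸ Measure.isProbabilityMeasure_map hp.aemeasurable
  have h2 : IsProbabilityMeasure ((ρ.prod η).map j) :=
    Measure.isProbabilityMeasure_map hj.aemeasurable
  refine eq_of_map_prod_eq_ergodic herg hμ η ha (e := 1) (by simpa using hjz) haS ?_
  subst hρ
  exact map_prod_mul_left hp hk hj μ η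

/-- The orbit of `y` avoids the exceptional sets where `ψ'` differs from `ψ ∘ π` or where `σ` is not
a left inverse of `π`. -/
def IsRegularPoint {X X' G : Type*} (T' : Equiv.Perm X') (π : X' → X) (σ : X → X') (ψ : X → G)
    (ψ' : X' → G) (y : X') : Prop :=
  ∀ n : ℤ, ψ' ((T' ^ n) y) = ψ (π ((T' ^ n) y)) ∧ σ (π ((T' ^ n) y)) = (T' ^ n) y

namespace IsRegularPoint

variable {X X' G : Type*} {T : Equiv.Perm X} {T' : Equiv.Perm X'} {π : X' → X}
  {σ : X → X'} {ψ : X → G} {ψ' : X' → G} {y : X'}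

theorem map_zpow_skewProduct [Group G] (hy : IsRegularPoint T' π σ ψ ψ' y)
    (hπ : ∀ z, π (T' z) = T (π z)) (n : ℤ) (g : G) :
    Prod.map π id ((skewProduct T' ψ' ^ n) (y, g)) = (skewProduct T ψ ^ n) (π y, g) := by
  refine zpow_semiconj_of_orbit (φ := Prod.map π id) (x := (y, g)) (fun n => ?_) n
  have h1 := skewProduct_zpow_fst T' ψ' n (y, g)
  generalize (skewProduct T' ψ' ^ n) (y, g) = q at h1 ⊢
  obtain ⟨z, h⟩ := q
  obtain rfl : z = (T' ^ n) y := h1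
  simp [skewProduct, hπ, (hy n).1]

theorem section_zpow_skewProduct [Group G] (hy : IsRegularPoint T' π σ ψ ψ' y)
    (hπ : ∀ z, π (T' z) = T (π z)) (n : ℤ) (g : G) :
    Prod.map σ id ((skewProduct T ψ ^ n) (π y, g)) = (skewProduct T' ψ' ^ n) (y, g) := by
  rw [← hy.map_zpow_skewProduct hπ]
  ext
  · simp only [Prod.map_fst, skewProduct_zpow_fst]
    exact (hy n).2
  · rfl

theorem section_zpow (hy : IsRegularPoint T' π σ ψ ψ' y) (hπ : ∀ z, π (T' z) = T (π z)) (n : ℤ) :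
    σ ((T ^ n) (π y)) = (T' ^ n) y := by
  rw [← zpow_semiconj hπ]
  exact (hy n).2

end IsRegularPoint

theorem ae_isRegularPoint {X X' G : Type*} [MeasurableSpace X'] {μ : Measure X'}
    {T' : Equiv.Perm X'} (hT' : MeasurePreserving T' μ μ) (hT'm : Measurable T'.symm)
    {π : X' → X} {σ : X → X'} {ψ : X → G} {ψ' : X' → G} (hψ : ψ' =ᵐ[μ] ψ ∘ π)
    (hσ : ∀ᵐ y ∂μ, σ (π y) = y) : ∀ᵐ y ∂μ, IsRegularPoint T' π σ ψ ψ' y := by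
  refine ae_all_iff.2 fun n => ?_
  exact (measurePreserving_perm_zpow hT' hT'm n).quasiMeasurePreserving.ae (hψ.and hσ)

theorem graphJoining_map_fst {X : Type*} [MeasurableSpace X] {μ : Measure X} {R : X → X}
    (hR : Measurable R) : (graphJoining μ R).map Prod.fst = μ := by
  rw [graphJoining, Measure.map_map measurable_fst (by fun_prop)]
  exact Measure.map_id

theorem graphJoining_map_snd {X : Type*} [MeasurableSpace X] {μ : Measure X} {R : X → X}
    (hR : MeasurePreserving R μ μ) : (graphJoining μ R).map Prod.snd = μ := by
  have := hR.measurable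
  rw [graphJoining, Measure.map_map measurable_snd (by fun_prop)]
  exact hR.map_eq

theorem map_prodMap_eq_of_ae_leftInverse {X X' Y Y' : Type*} [MeasurableSpace X]
    [MeasurableSpace X'] [MeasurableSpace Y] [MeasurableSpace Y'] {μ : Measure X'} {ν : Measure Y'}
    {π : X' → X} {σ : X → X'} {θ : Y' → Y} {τ : Y → Y'} (hπ : Measurable π) (hσ : Measurable σ)
    (hθ : Measurable θ) (hτ : Measurable τ)
    {κ : Measure (X' × Y')} (h₁ : κ.map Prod.fst = μ) (h₂ : κ.map Prod.snd = ν)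
    (hσπ : ∀ᵐ y ∂μ, σ (π y) = y) (hτθ : ∀ᵐ y ∂ν, τ (θ y) = y) :
    (κ.map (Prod.map π θ)).map (Prod.map σ τ) = κ := by
  refine map_eq_of_ae_leftInverse (by fun_prop) (by fun_prop) ?_
  filter_upwards [ae_of_ae_map measurable_fst.aemeasurable (h₁ ▸ hσπ),
    ae_of_ae_map measurable_snd.aemeasurable (h₂ ▸ hτθ)] with q hq₁ hq₂
  exact Prod.ext hq₁ hq₂

theorem map_prodMap_fst {X X' Y Y' : Type*} [MeasurableSpace X]
    [MeasurableSpace X'] [MeasurableSpace Y] [MeasurableSpace Y'] {κ : Measure (X' × Y')}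
    {π : X' → X} {θ : Y' → Y} (hπ : Measurable π) (hθ : Measurable θ) :
    (κ.map (Prod.map π θ)).map Prod.fst = (κ.map Prod.fst).map π := by
  rw [Measure.map_map measurable_fst (by fun_prop), Measure.map_map hπ measurable_fst]
  rfl

theorem map_prodMap_snd {X X' Y Y' : Type*} [MeasurableSpace X]
    [MeasurableSpace X'] [MeasurableSpace Y] [MeasurableSpace Y'] {κ : Measure (X' × Y')}
    {π : X' → X} {θ : Y' → Y} (hπ : Measurable π) (hθ : Measurable θ) :
    (κ.map (Prod.map π θ)).map Prod.snd = (κ.map Prod.snd).map θ := by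
  rw [Measure.map_map measurable_snd (by fun_prop), Measure.map_map hθ measurable_snd]
  rfl

theorem map_prodRegroup_prodMap {X X' Y Y' G H : Type*} [MeasurableSpace X] [MeasurableSpace X']
    [MeasurableSpace Y] [MeasurableSpace Y'] [MeasurableSpace G] [MeasurableSpace H]
    {π : X' → X} {θ : Y' → Y} (hπ : Measurable π) (hθ : Measurable θ) (ρ : Measure (X' × Y'))
    [SFinite ρ] (η : Measure (G × H)) [SFinite η] :
    ((ρ.prod η).map prodRegroup).map (Prod.map (Prod.map π id) (Prod.map θ id)) =
      ((ρ.map (Prod.map π θ)).prod η).map prodRegroup := by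
  conv_rhs => rw [← Measure.map_id (μ := η)]
  rw [Measure.map_prod_map _ _ (by fun_prop) measurable_id,
    Measure.map_map (by fun_prop) measurable_prodRegroup,
    Measure.map_map measurable_prodRegroup (by fun_prop)]
  rfl

theorem map_prodRegroup_base {X Y G H : Type*} [MeasurableSpace X] [MeasurableSpace Y]
    [MeasurableSpace G] [MeasurableSpace H] (ρ : Measure (X × Y)) (η : Measure (G × H))
    [IsProbabilityMeasure η] :
    ((ρ.prod η).map prodRegroup).map (Prod.map Prod.fst Prod.fst) = ρ := by
  rw [Measure.map_map (by fun_prop) measurable_prodRegroup]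
  exact measurePreserving_fst.map_eq

/-! ### The lifted joining, its group extension and their generic points. -/

theorem exists_isGenericLift_of_section
    {X : Type*} [TopologicalSpace X] [SecondCountableTopology X] [MeasurableSpace X] [BorelSpace X]
    [HasOuterApproxClosed (X × X)]
    {T : Equiv.Perm X} {mX : Measure X} [IsProbabilityMeasure mX]
    {G : Type*} [Group G] [MetricSpace G] [CompactSpace G] [IsTopologicalGroup G]
    [MeasurableSpace G] [BorelSpace G] [StandardBorelSpace (X × G)] [Nonempty (X × G)]
    (mG : Measure G) [mG.IsHaarMeasure] [IsProbabilityMeasure mG]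
    {X' : Type*} [MetricSpace X'] [CompactSpace X'] [Nonempty X']
    [MeasurableSpace X'] [BorelSpace X']
    {T' : X' ≃ₜ X'} {mX' : Measure X'} [IsProbabilityMeasure mX']
    (hT' : IsUniquelyErgodic T' mX')
    {π : X' → X} (hπ : IsTopologicalFactor T' T π)
    {σ : X → X'} (hσ : MeasurePreserving σ mX mX') (hπm : MeasurePreserving π mX' mX)
    (hπσ : ∀ᵐ x ∂mX, π (σ x) = x) (hσπ : ∀ᵐ y ∂mX', σ (π y) = y)
    {ψ : X → G} {ψ' : X' → G} (hψ' : Continuous ψ') (hψψ' : ψ' =ᵐ[mX'] ψ ∘ π)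
    {r s : ℤ} (hr0 : r ≠ 0) (hs0 : s ≠ 0)
    (hr : Ergodic ⇑(skewProduct T ψ ^ r) (mX.prod mG))
    (hs : Ergodic ⇑(skewProduct T ψ ^ s) (mX.prod mG))
    (hTr : Ergodic ⇑(T ^ r) mX) (hTs : Ergodic ⇑(T ^ s) mX)
    (hjoin : ∀ κ : Measure ((X × G) × (X × G)),
      IsErgodicJoining (mX.prod mG) (mX.prod mG)
        ⇑(skewProduct T ψ ^ r) ⇑(skewProduct T ψ ^ s) κ →
      ∃ R : X → X, IsMeasureIso mX mX ⇑(T ^ r) ⇑(T ^ s) R ∧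
        κ = relIndepExtension (mX.prod mG) (mX.prod mG) Prod.fst Prod.fst (graphJoining mX R))
    (x' : X') {R : X → X} (hR : IsMeasureIso mX mX ⇑(T ^ r) ⇑(T ^ s) R)
    (hgen : IsGeneric (Prod.map ⇑(T ^ r) ⇑(T ^ s)) (π x', π x') (graphJoining mX R)) :
    ∃ ρ' : Measure (X' × X'),
      IsGenericLift (Prod.map ⇑(T'.toEquiv ^ r) ⇑(T'.toEquiv ^ s)) (Prod.map π π)
        (π x', π x') ρ' ∧
      (∀ ρ'' : Measure (X' × X'),
        IsGenericLift (Prod.map ⇑(T'.toEquiv ^ r) ⇑(T'.toEquiv ^ s)) (Prod.map π π)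
          (π x', π x') ρ'' → ρ'' = ρ') ∧
      (∀ g : G,
        IsGeneric
          (Prod.map ⇑(skewProduct T'.toEquiv ψ' ^ r) ⇑(skewProduct T'.toEquiv ψ' ^ s))
          ((x', g), (x', g))
          (relIndepExtension (mX'.prod mG) (mX'.prod mG) Prod.fst Prod.fst ρ')) ∧
      MeasureIsomorphic
        (relIndepExtension (mX'.prod mG) (mX'.prod mG) Prod.fst Prod.fst ρ')
        (relIndepExtension (mX.prod mG) (mX.prod mG) Prod.fst Prod.fst (graphJoining mX R))
        (Prod.map ⇑(skewProduct T'.toEquiv ψ' ^ r) ⇑(skewProduct T'.toEquiv ψ' ^ s))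
        (Prod.map ⇑(skewProduct T ψ ^ r) ⇑(skewProduct T ψ ^ s)) := by
  have hπT (z) : π (T'.toEquiv z) = T (π z) := congrFun hπ.equivariant z
  have hσm := hσ.measurable
  have hπm' := hπm.measurable
  have hTc (n : ℤ) : Continuous ⇑(T'.toEquiv ^ n) :=
    continuous_perm_zpow T'.continuous T'.symm.continuous n
  have hSc (n : ℤ) : Continuous ⇑(skewProduct T'.toEquiv ψ' ^ n) :=
    continuous_skewProduct_zpow T' hψ' n
  have hreg : ∀ᵐ y ∂mX', IsRegularPoint T'.toEquiv π σ ψ ψ' y :=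
    ae_isRegularPoint hT'.measurePreserving T'.symm.continuous.measurable hψψ' hσπ
  have hregσ : ∀ᵐ x ∂mX, IsRegularPoint T'.toEquiv π σ ψ ψ' (σ x) ∧ π (σ x) = x :=
    (hσ.quasiMeasurePreserving.ae hreg).and hπσ
  -- the measures on the bases
  set κ := graphJoining mX R with hκ
  have hRm := hR.measurePreserving.measurable
  have hκp : IsProbabilityMeasure κ := Measure.isProbabilityMeasure_map (by fun_prop)
  have hκ₁ : κ.map Prod.fst = mX := graphJoining_map_fst hRm
  have hκ₂ : κ.map Prod.snd = mX := graphJoining_map_snd hR.measurePreserving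
  have hκe : Ergodic (Prod.map ⇑(T ^ r) ⇑(T ^ s)) κ := by
    refine hTr.map_of_ae_semiconj (by fun_prop) (hTr.measurable.prodMap hTs.measurable) ?_
    filter_upwards [hR.equivariant] with x hx
    exact Prod.ext rfl hx
  set ρ := κ.map (Prod.map σ σ) with hρ
  have hρp : IsProbabilityMeasure ρ := Measure.isProbabilityMeasure_map (by fun_prop)
  have hρ₁ : ρ.map Prod.fst = mX' := by rw [hρ, map_prodMap_fst hσm hσm, hκ₁, hσ.map_eq]
  have hρ₂ : ρ.map Prod.snd = mX' := by rw [hρ, map_prodMap_snd hσm hσm, hκ₂, hσ.map_eq]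
  have hρκ : ρ.map (Prod.map π π) = κ :=
    map_prodMap_eq_of_ae_leftInverse hσm hπm' hσm hπm' hκ₁ hκ₂ hπσ hπσ
  have hρe : Ergodic (Prod.map ⇑(T'.toEquiv ^ r) ⇑(T'.toEquiv ^ s)) ρ := by
    refine hκe.map_of_ae_semiconj (by fun_prop)
      ((hTc r).measurable.prodMap (hTc s).measurable) ?_
    filter_upwards [ae_of_ae_map measurable_fst.aemeasurable (hκ₁ ▸ hregσ),
      ae_of_ae_map measurable_snd.aemeasurable (hκ₂ ▸ hregσ)] with q hq₁ hq₂
    refine Prod.ext ?_ ?_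
    · have := hq₁.1.section_zpow hπT r
      rwa [hq₁.2] at this
    · have := hq₂.1.section_zpow hπT s
      rwa [hq₂.2] at this
  have hmarg {n : ℤ} (hn : n ≠ 0) {ν : Measure X'} [IsProbabilityMeasure ν]
      (hν : MeasurePreserving ⇑(T'.toEquiv ^ n) ν ν) (h : ν.map π = mX) : ν = mX' :=
    IsUniquelyErgodic.eq_of_zpow (A := T'.toEquiv) hT' hn hν (hTc _).measurable hπm' hσm hσπ
      (h.trans hπm.map_eq.symm)
  -- Both marginals are `mX'`, so `σ × σ` inverts `π × π` almost everywhere for `μ`.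
  have hρuniq (μ : Measure (X' × X')) (hμ : IsProbabilityMeasure μ)
      (hμT : MeasurePreserving (Prod.map ⇑(T'.toEquiv ^ r) ⇑(T'.toEquiv ^ s)) μ μ)
      (hμκ : μ.map (Prod.map π π) = κ) : μ = ρ := by
    have := Measure.isProbabilityMeasure_map (μ := μ) measurable_fst.aemeasurable
    have := Measure.isProbabilityMeasure_map (μ := μ) measurable_snd.aemeasurable
    have h1 : μ.map Prod.fst = mX' := hmarg hr0
      ⟨(hTc r).measurable, by
        rw [← map_prodMap_fst (hTc r).measurable (hTc s).measurable, hμT.map_eq]⟩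
      (by rw [← map_prodMap_fst hπm' hπm', hμκ, hκ₁])
    have h2 : μ.map Prod.snd = mX' := hmarg hs0
      ⟨(hTc s).measurable, by
        rw [← map_prodMap_snd (hTc r).measurable (hTc s).measurable, hμT.map_eq]⟩
      (by rw [← map_prodMap_snd hπm' hπm', hμκ, hκ₂])
    rw [hρ, ← hμκ]
    exact (map_prodMap_eq_of_ae_leftInverse hπm' hσm hπm' hσm h1 h2 hσπ hσπ).symm
  have hρgen (z : X' × X') (hz : Prod.map π π z = (π x', π x')) :
      IsGeneric (Prod.map ⇑(T'.toEquiv ^ r) ⇑(T'.toEquiv ^ s)) z ρ := by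
    refine isGeneric_of_unique_invariant ((hTc r).prodMap (hTc s))
      (hπ.continuous.prodMap hπ.continuous) ?_ (hz ▸ hgen) hρuniq
    funext q
    exact Prod.ext (zpow_semiconj hπT r q.1) (zpow_semiconj hπT s q.2)
  have hρlift : IsGenericLift (Prod.map ⇑(T'.toEquiv ^ r) ⇑(T'.toEquiv ^ s)) (Prod.map π π)
      (π x', π x') ρ := ⟨hρp, hρe.toMeasurePreserving, hρgen⟩
  -- the fibre coordinates
  set S' := Prod.map ⇑(skewProduct T'.toEquiv ψ' ^ r) ⇑(skewProduct T'.toEquiv ψ' ^ s) with hS'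
  have hS'c : Continuous S' := (hSc r).prodMap (hSc s)
  set m' : Measure ((X' × G) × (X' × G)) := (ρ.prod (mG.prod mG)).map prodRegroup with hm'
  have hpS' : (Prod.map Prod.fst Prod.fst : (X' × G) × (X' × G) → X' × X') ∘ S' =
      Prod.map ⇑(T'.toEquiv ^ r) ⇑(T'.toEquiv ^ s) ∘ Prod.map Prod.fst Prod.fst := by
    funext q
    exact Prod.ext (skewProduct_zpow_fst _ _ r q.1) (skewProduct_zpow_fst _ _ s q.2)
  have hpc : Continuous (Prod.map Prod.fst Prod.fst : (X' × G) × (X' × G) → X' × X') :=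
    continuous_fst.prodMap continuous_fst
  have hskew' {n : ℤ} (hn : Ergodic ⇑(skewProduct T ψ ^ n) (mX.prod mG)) :
      Ergodic ⇑(skewProduct T'.toEquiv ψ' ^ n) (mX'.prod mG) := by
    have e : (mX.prod mG).map (Prod.map σ id) = mX'.prod mG := by
      rw [← Measure.map_prod_map _ _ hσm measurable_id, hσ.map_eq, Measure.map_id]
    rw [← e]
    refine hn.map_of_ae_semiconj (by fun_prop) (hSc n).measurable ?_
    filter_upwards [measurePreserving_fst.quasiMeasurePreserving.ae hregσ] with q hq
    have := hq.1.section_zpow_skewProduct hπT n q.2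
    rwa [hq.2] at this
  have hmarg' {n : ℤ} (hn : Ergodic ⇑(skewProduct T ψ ^ n) (mX.prod mG))
      {ν : Measure (X' × G)} [IsProbabilityMeasure ν]
      (hν : MeasurePreserving ⇑(skewProduct T'.toEquiv ψ' ^ n) ν ν) (h : ν.map Prod.fst = mX') :
      ν = mX'.prod mG := by
    have := eq_map_prod_of_ergodic mG (j := id) measurable_fst measurable_snd measurable_id
      (by simp only [id]; fun_prop) (fun _ => rfl)
      (fun z g => skewProduct_zpow_mul T'.toEquiv ψ' n z g) hν h
      (by rw [Measure.map_id]; exact hskew' hn)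
    rwa [Measure.map_id] at this
  have hsemi {μ : Measure ((X' × G) × (X' × G))} (h : μ.map (Prod.map Prod.fst Prod.fst) = ρ) :
      Prod.map (Prod.map π id) (Prod.map π id) ∘ S' =ᵐ[μ]
        Prod.map ⇑(skewProduct T ψ ^ r) ⇑(skewProduct T ψ ^ s) ∘
          Prod.map (Prod.map π id) (Prod.map π id) := by
    have e₁ := ae_of_ae_map hpc.measurable.aemeasurable (h.symm ▸
      ae_of_ae_map measurable_fst.aemeasurable (hρ₁ ▸ hreg))
    have e₂ := ae_of_ae_map hpc.measurable.aemeasurable (h.symm ▸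
      ae_of_ae_map measurable_snd.aemeasurable (hρ₂ ▸ hreg))
    filter_upwards [e₁, e₂] with q hq₁ hq₂
    exact Prod.ext (hq₁.map_zpow_skewProduct hπT r q.1.2) (hq₂.map_zpow_skewProduct hπT s q.2.2)
  have hσπG : ∀ᵐ q ∂(mX'.prod mG), Prod.map σ id (Prod.map π id q) = q := by
    filter_upwards [measurePreserving_fst.quasiMeasurePreserving.ae hσπ] with q hq
    exact Prod.ext hq rfl
  have hm'p : m'.map (Prod.map Prod.fst Prod.fst) = ρ := map_prodRegroup_base ρ (mG.prod mG)
  have hm'π : m'.map (Prod.map (Prod.map π id) (Prod.map π id)) =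
      (κ.prod (mG.prod mG)).map prodRegroup := by
    rw [hm', map_prodRegroup_prodMap hπm' hπm', hρκ]
  -- An ergodic measure over `ρ` exists; its image in `(X × G) × (X × G)` is an ergodic joining,
  -- hence relatively independent over some `R₁`. Comparing projections identifies the graph joining
  -- of `R₁` with `κ`, so the measure is `m'`.
  have hm'e : Ergodic S' m' := by
    obtain ⟨μ₁, -, h₁, h₁'⟩ := exists_invariant_limit hS'c hpc hpS' (z := ((x', 1), (x', 1)))
      (hρgen (x', x') rfl) (Ultrafilter.of atTop) (Ultrafilter.of_le _)
    obtain ⟨μ, hμp, hμe, hμρ⟩ := exists_ergodic_of_exists_invariant hS'c hpc hpS' hρe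
      ⟨μ₁, inferInstance, h₁, h₁'⟩
    have := Measure.isProbabilityMeasure_map (μ := μ) measurable_fst.aemeasurable
    have := Measure.isProbabilityMeasure_map (μ := μ) measurable_snd.aemeasurable
    have hμ₁ : μ.map Prod.fst = mX'.prod mG := hmarg' hr
      ⟨(hSc r).measurable, by
        rw [← map_prodMap_fst (hSc r).measurable (hSc s).measurable,
          hμe.toMeasurePreserving.map_eq]⟩
      (by rw [← map_prodMap_fst measurable_fst measurable_fst, hμρ, hρ₁])
    have hμ₂ : μ.map Prod.snd = mX'.prod mG := hmarg' hs
      ⟨(hSc s).measurable, by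
        rw [← map_prodMap_snd (hSc r).measurable (hSc s).measurable,
          hμe.toMeasurePreserving.map_eq]⟩
      (by rw [← map_prodMap_snd measurable_fst measurable_fst, hμρ, hρ₂])
    have hprod : (mX'.prod mG).map (Prod.map π id) = mX.prod mG := by
      rw [← Measure.map_prod_map _ _ hπm' measurable_id, hπm.map_eq, Measure.map_id]
    have hπG : Measurable (Prod.map π id : X' × G → X × G) := by fun_prop
    have hσG : Measurable (Prod.map σ id : X × G → X' × G) := by fun_prop
    obtain ⟨R₁, hR₁, e⟩ := hjoin (μ.map (Prod.map (Prod.map π id) (Prod.map π id)))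
      ⟨by rw [map_prodMap_fst hπG hπG, hμ₁, hprod], by rw [map_prodMap_snd hπG hπG, hμ₂, hprod],
        hμe.map_of_ae_semiconj (by fun_prop) (hr.measurable.prodMap hs.measurable) (hsemi hμρ)⟩
    have hR₁m := hR₁.measurePreserving.measurable
    have : IsProbabilityMeasure (graphJoining mX R₁) :=
      Measure.isProbabilityMeasure_map (by fun_prop)
    rw [relIndepExtension_prod mG mG (graphJoining_map_fst hR₁m)
      (graphJoining_map_snd hR₁.measurePreserving)] at e
    have hκ' : graphJoining mX R₁ = κ := by
      rw [← map_prodRegroup_base (graphJoining mX R₁) (mG.prod mG), ← e, ← hρκ, ← hμρ,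
        Measure.map_map (by fun_prop) (by fun_prop), Measure.map_map (by fun_prop) (by fun_prop)]
      rfl
    have hμm' : μ = m' := by
      rw [← map_prodMap_eq_of_ae_leftInverse hπG hσG hπG hσG hμ₁ hμ₂ hσπG hσπG, e, hκ',
        map_prodRegroup_prodMap hσm hσm]
    rwa [← hμm']
  have hm'uniq (μ : Measure ((X' × G) × (X' × G))) (hμ : IsProbabilityMeasure μ)
      (hμS : MeasurePreserving S' μ μ) (hμρ : μ.map (Prod.map Prod.fst Prod.fst) = ρ) : μ = m' :=
    eq_map_prod_of_ergodic (K := (X' × G) × (X' × G)) (mG.prod mG) (p := Prod.map Prod.fst Prod.fst)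
      (k := Prod.map Prod.snd Prod.snd) (j := prodRegroup) (by fun_prop) (by fun_prop)
      measurable_prodRegroup (by unfold prodRegroup; fun_prop) (fun _ => rfl)
      (fun z h => Prod.ext (skewProduct_zpow_mul T'.toEquiv ψ' r z.1 h.1)
        (skewProduct_zpow_mul T'.toEquiv ψ' s z.2 h.2)) hμS hμρ hm'e
  refine ⟨ρ, hρlift, fun ρ'' h => ?_, ?_⟩
  · have := h.isProbabilityMeasure
    -- A point is generic for at most one measure, and `(x', x')` lies in the fibre.
    exact (h.isGeneric (x', x') rfl).unique (hρgen (x', x') rfl)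
  rw [relIndepExtension_prod mG mG hρ₁ hρ₂, relIndepExtension_prod mG mG hκ₁ hκ₂, ← hm', ← hm'π]
  refine ⟨fun g => isGeneric_of_unique_invariant hS'c hpc hpS' (z := ((x', g), (x', g)))
    (hρgen (x', x') rfl) hm'uniq,
    Prod.map (Prod.map π id) (Prod.map π id), ⟨by fun_prop, rfl⟩, hsemi hm'p,
    Prod.map (Prod.map σ id) (Prod.map σ id), ⟨by fun_prop, ?_⟩, ?_, ?_⟩
  · rw [hm'π, map_prodRegroup_prodMap hσm hσm]
  · have e₁ := ae_of_ae_map hpc.measurable.aemeasurable (hm'p.symm ▸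
      ae_of_ae_map measurable_fst.aemeasurable (hρ₁ ▸ hσπ))
    have e₂ := ae_of_ae_map hpc.measurable.aemeasurable (hm'p.symm ▸
      ae_of_ae_map measurable_snd.aemeasurable (hρ₂ ▸ hσπ))
    filter_upwards [e₁, e₂] with q hq₁ hq₂
    exact Prod.ext (Prod.ext hq₁ rfl) (Prod.ext hq₂ rfl)
  · rw [hm'π]
    have hκb := map_prodRegroup_base κ (mG.prod mG)
    have e₁ := ae_of_ae_map (by fun_prop) (hκb.symm ▸
      ae_of_ae_map measurable_fst.aemeasurable (hκ₁ ▸ hπσ))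
    have e₂ := ae_of_ae_map (by fun_prop) (hκb.symm ▸
      ae_of_ae_map measurable_snd.aemeasurable (hκ₂ ▸ hπσ))
    filter_upwards [e₁, e₂] with q hq₁ hq₂
    exact Prod.ext (Prod.ext hq₁ rfl) (Prod.ext hq₂ rfl)

theorem mainTheorem9
    -- the odometer `(X, T, m_X)`
    (lam : ℕ → ℕ) (hlam : ∀ t, 2 ≤ lam t)
    (mX : Measure (Odometer lam)) [mX.IsAddHaarMeasure] [IsProbabilityMeasure mX]
    -- the compact metric group `G`
    {G : Type*} [Group G] [MetricSpace G] [CompactSpace G] [IsTopologicalGroup G]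
    [MeasurableSpace G] [BorelSpace G]
    (mG : Measure G) [mG.IsHaarMeasure] [IsProbabilityMeasure mG]
    -- the uniquely ergodic extension `(X', T', mX')` of the odometer
    {X' : Type*} [MetricSpace X'] [CompactSpace X'] [Nonempty X']
    [MeasurableSpace X'] [BorelSpace X']
    (T' : X' ≃ₜ X') (mX' : Measure X') [IsProbabilityMeasure mX']
    (hT' : IsUniquelyErgodic T' mX')
    (π : X' → Odometer lam) (hπ : IsTopologicalFactor T' (Odometer.shift lam) π)
    (hiso : MeasureIsomorphic mX mX' (Odometer.shift lam) T')
    -- the ergodic cocycle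
    (ψ : Odometer lam → G) (hψ : Measurable ψ)
    (hψerg : Ergodic (skewProduct (Odometer.shift lam) ψ) (mX.prod mG))
    -- its continuous version on `X'`
    (ψ' : X' → G) (hψ' : Continuous ψ') (hψψ' : ψ' =ᵐ[mX'] ψ ∘ π)
    -- the powers
    (r s : ℤ) (hrs : r ≠ s)
    (hr : Ergodic ⇑(skewProduct (Odometer.shift lam) ψ ^ r) (mX.prod mG))
    (hs : Ergodic ⇑(skewProduct (Odometer.shift lam) ψ ^ s) (mX.prod mG))
    -- the only ergodic joinings are the relatively independent extensions
    (hjoin : ∀ κ : Measure ((Odometer lam × G) × (Odometer lam × G)),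
      IsErgodicJoining (mX.prod mG) (mX.prod mG)
        ⇑(skewProduct (Odometer.shift lam) ψ ^ r) ⇑(skewProduct (Odometer.shift lam) ψ ^ s) κ →
      ∃ R : Odometer lam → Odometer lam,
        IsMeasureIso mX mX ⇑(Odometer.shift lam ^ r) ⇑(Odometer.shift lam ^ s) R ∧
        κ = relIndepExtension (mX.prod mG) (mX.prod mG) Prod.fst Prod.fst (graphJoining mX R))
    (x' : X') :
    (∃ R : Odometer lam → Odometer lam,
      IsMeasureIso mX mX ⇑(Odometer.shift lam ^ r) ⇑(Odometer.shift lam ^ s) R ∧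
      IsGeneric (Prod.map ⇑(Odometer.shift lam ^ r) ⇑(Odometer.shift lam ^ s)) (π x', π x')
        (graphJoining mX R)) ∧
    ∀ R : Odometer lam → Odometer lam,
      IsMeasureIso mX mX ⇑(Odometer.shift lam ^ r) ⇑(Odometer.shift lam ^ s) R →
      IsGeneric (Prod.map ⇑(Odometer.shift lam ^ r) ⇑(Odometer.shift lam ^ s)) (π x', π x')
        (graphJoining mX R) →
      ∃ ρ' : Measure (X' × X'),
        -- `ρ'` is the unique invariant measure for which all points over `(π x', π x')` are generic
        IsGenericLift (Prod.map ⇑(T'.toEquiv ^ r) ⇑(T'.toEquiv ^ s)) (Prod.map π π)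
          (π x', π x') ρ' ∧
        (∀ ρ'' : Measure (X' × X'),
          IsGenericLift (Prod.map ⇑(T'.toEquiv ^ r) ⇑(T'.toEquiv ^ s)) (Prod.map π π)
            (π x', π x') ρ'' → ρ'' = ρ') ∧
        (∀ g : G,
          IsGeneric
            (Prod.map ⇑(skewProduct T'.toEquiv ψ' ^ r)
              ⇑(skewProduct T'.toEquiv ψ' ^ s))
            ((x', g), (x', g))
            (relIndepExtension (mX'.prod mG) (mX'.prod mG) Prod.fst Prod.fst ρ')) ∧
        MeasureIsomorphic
          (relIndepExtension (mX'.prod mG) (mX'.prod mG) Prod.fst Prod.fst ρ')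
          (relIndepExtension (mX.prod mG) (mX.prod mG) Prod.fst Prod.fst (graphJoining mX R))
          (Prod.map ⇑(skewProduct T'.toEquiv ψ' ^ r)
            ⇑(skewProduct T'.toEquiv ψ' ^ s))
          (Prod.map ⇑(skewProduct (Odometer.shift lam) ψ ^ r)
            ⇑(skewProduct (Odometer.shift lam) ψ ^ s)) := by 
  have hX : Nonempty (Odometer lam × G) := ⟨(0, 1)⟩
  -- Ergodicity passes to the base, which is a factor; `n = 1` covers the odometer itself.
  have hbase {n : ℤ} (hn : Ergodic ⇑(skewProduct (Odometer.shift lam) ψ ^ n) (mX.prod mG)) :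
      Ergodic ⇑(Odometer.shift lam ^ n) mX := by
    have hm : Measurable ⇑(Odometer.shift lam ^ n) := by
      simp only [funext (Odometer.shift_zpow_apply (lam := lam) n)]
      fun_prop
    have := hn.map_of_ae_semiconj measurable_fst hm
      (ae_of_all _ fun q => skewProduct_zpow_fst _ _ n q)
    rwa [measurePreserving_fst.map_eq] at this
  have hTr := hbase hr
  have hTs := hbase hs
  have hT : Ergodic (Odometer.shift lam) mX := by
    simpa only [zpow_one] using hbase (n := 1) (by simpa only [zpow_one] using hψerg)
  obtain ⟨σ, hσ, hπm, hπσ, hσπ⟩ := Odometer.exists_ae_inverse hT hπ.continuous.measurable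
    hπ.equivariant hiso
  refine ⟨Odometer.exists_isMeasureIso_isGeneric hlam hTr hTs (π x'), fun R hR hgen => ?_⟩
  exact exists_isGenericLift_of_section mG hT' hπ hσ hπm hπσ hσπ hψ' hψψ'
    (Odometer.zpow_ne_zero_of_ergodic hlam hTr) (Odometer.zpow_ne_zero_of_ergodic hlam hTs)
    hr hs hTr hTs hjoin x' hR hgen
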